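/- Let $k$ be a perfect field, $R$ a smooth finitely generated $k$-algebra, and $A\simeq R/J$ a catenarian equidimensional ring with $\dim A=d$ (a non-negative integer) and $\operatorname{ht} J=g$, all minimal primes of $J$ having the same height $g$ (this is automatic if $R$ is a domain, or if $\operatorname{Spec} A$ is connected). Let $E$ be a finitely generated $A$-module of rank $r$, i.e. $E_{\mathfrak p}\simeq A_{\mathfrak p}^r$ for every associated prime $\mathfrak p$ of $A$, let $\tau_A(E)$ be its torsion submodule, and let an embedding $E/\tau_A(E)\subset F$ into a free $A$-module $F=A^n$ of rank $n$ be given. For a surjection of $k$-algebras $R'\twoheadrightarrow A$ with $R'$ of finite type, let $\mathbf E_{R'}\subset R'^n$ be the preimage of $E/\tau_A(E)$ under $R'^n\to A^n$, let $\mathcal R_{R'}(\mathbf E_{R'})$ be its Rees algebra, i.e. the image of $\mathcal S_{R'}(\mathbf E_{R'})\to\mathcal S_{R'}(R'^n)$ (where $\mathcal S$ denotes the symmetric algebra), and put $$\mathcal A_{R'\twoheadrightarrow A}(E)=\mathcal S_A(E/\tau_A(E))\otimes_{\mathcal S_{R'}(\mathbf E_{R'})}\mathcal R_{R'}(\mathbf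 E_{R'}).$$ The Aluffi algebra of $E$ (with its given embedding) is the inverse limit $\mathcal A_A(E)=\varprojlim \mathcal A_{R'\twoheadrightarrow A}(E)$ over all such surjections, with transition maps induced by the surjective $k$-algebra maps $R'\to R''$ over $A$. For a finite free presentation $A^q\xrightarrow{\ \phi\ }A^m\to E\to 0$, let $I_t(\phi)$ be the ideal of $t\times t$ minors, $\operatorname{rk}(\phi)$ the largest $t$ with $I_t(\phi)\ne0$, and $$\mathrm{df}(E)=\max_{1\le t\le \operatorname{rk}(\phi)}\max\{0,\ \operatorname{rk}(\phi)-t+1-\operatorname{ht} I_t(\phi)\},$$ where the unit ideal has height $\infty$ and the maximum over the empty set is $0$. Then, for every such presentation, $$d+r\ \le\ \dim \mathcal A_A(E)\ \le\ \min\{\,d+n+g,\ d+r+\mathrm{df}(E)\,\}.$$ -/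

import Mathlib

namespace ModuleAluffi

noncomputable section

/-! ### Dimension-theoretic notions -/

/-- `A` is catenary (catenarian): any two saturated chains of primes with the same endpoints have
the same length. -/
def IsCatenary (A : Type*) [CommRing A] : Prop :=
  ∀ s t : RelSeries {(p, q) : PrimeSpectrum A × PrimeSpectrum A | p ⋖ q},
    s.head = t.head → s.last = t.last → s.length = t.length

/-- `A` is equidimensional: `dim A/p = dim A` for every minimal prime `p` of `A`. -/
def IsEquidimensional (A : Type*) [CommRing A] : Prop :=
  ∀ p ∈ minimalPrimes A, ringKrullDim (A ⧸ p) = ringKrullDim A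

/-- `E` has (generic) rank `r`: `E_p` is `A_p`-free of rank `r` for every associated prime `p`
of `A`. -/
def HasRank (A : Type*) [CommRing A] (E : Type*) [AddCommGroup E] [Module A E] (r : ℕ) : Prop :=
  ∀ (p : Ideal A) [p.IsPrime], p ∈ associatedPrimes A A →
    Nonempty (LocalizedModule p.primeCompl E ≃ₗ[Localization.AtPrime p]
      (Fin r → Localization.AtPrime p))

/-! ### The Fitting defect of a presentation matrix -/

section Fitting

variable {A : Type*} [CommRing A] {m q : ℕ}

/-- `I_t(Z)`: the ideal generated by the `t × t` minors of `Z`. -/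
def minorsIdeal (Z : Matrix (Fin m) (Fin q) A) (t : ℕ) : Ideal A :=
  Ideal.span {x | ∃ (a : Fin t ↪o Fin m) (b : Fin t ↪o Fin q), x = (Z.submatrix a b).det}

open Classical in
/-- The (determinantal) rank of a matrix: the largest `t` with `I_t(Z) ≠ 0`. -/
def matrixRank (Z : Matrix (Fin m) (Fin q) A) : ℕ :=
  Nat.findGreatest (fun t => minorsIdeal Z t ≠ ⊥) (min m q)

/-- The Fitting defect `max_{1 ≤ t ≤ rk Z} max {0, rk Z - t + 1 - ht I_t(Z)}`. The subtraction in
`ℕ∞` is truncated at `0`; the unit ideal has height `⊤`, and the maximum over the empty set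
is `0`. -/
def fittingDefect (Z : Matrix (Fin m) (Fin q) A) : ℕ∞ :=
  (Finset.Icc 1 (matrixRank Z)).sup fun t =>
    ((matrixRank Z - t + 1 : ℕ) : ℕ∞) - (minorsIdeal Z t).height

end Fitting

/-! ### Symmetric algebras and semilinear maps -/

section SymMap

variable {R S : Type*} [CommRing R] [CommRing S]
variable {M N : Type*} [AddCommGroup M] [Module R M] [AddCommGroup N] [Module S N]

/-- The ring homomorphism `S_R(M) → S_S(N)` induced by a map `g : M → N` that is semilinear over
`f : R → S`. -/
def symMap (f : R →+* S) (g : M →ₛₗ[f] N) : SymmetricAlgebra R M →+* SymmetricAlgebra S N :=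
  letI : Algebra R (SymmetricAlgebra S N) :=
    ((algebraMap S (SymmetricAlgebra S N)).comp f).toAlgebra
  (SymmetricAlgebra.lift (R := R) (M := M) (A := SymmetricAlgebra S N)
    { toFun := fun x => SymmetricAlgebra.ι S N (g x)
      map_add' := fun x y => by simp
      map_smul' := fun c x => by
        rw [LinearMap.map_smulₛₗ, map_smul, RingHom.id_apply, Algebra.smul_def, Algebra.smul_def]
        rfl }).toRingHom

theorem symMap_ι (f : R →+* S) (g : M →ₛₗ[f] N) (x : M) :
    symMap f g (SymmetricAlgebra.ι R M x) = SymmetricAlgebra.ι S N (g x) := by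
  let _ : Algebra R (SymmetricAlgebra S N) :=
    ((algebraMap S (SymmetricAlgebra S N)).comp f).toAlgebra
  exact SymmetricAlgebra.lift_ι_apply _ x

theorem symMap_algebraMap (f : R →+* S) (g : M →ₛₗ[f] N) (c : R) :
    symMap f g (algebraMap R _ c) = algebraMap S _ (f c) := by
  let _ : Algebra R (SymmetricAlgebra S N) :=
    ((algebraMap S (SymmetricAlgebra S N)).comp f).toAlgebra
  exact AlgHom.commutes _ c

theorem symHom_ext {B : Type*} [CommRing B] {u v : SymmetricAlgebra R M →+* B}
    (h1 : ∀ c, u (algebraMap R _ c) = v (algebraMap R _ c))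
    (h2 : ∀ x, u (SymmetricAlgebra.ι R M x) = v (SymmetricAlgebra.ι R M x)) : u = v := by
  refine RingHom.ext fun z => ?_
  induction z using SymmetricAlgebra.induction with
  | algebraMap c => exact h1 c
  | ι x => exact h2 x
  | mul a b ha hb => rw [map_mul, map_mul, ha, hb]
  | add a b ha hb => rw [map_add, map_add, ha, hb]

end SymMap

/-! ### Rees algebra of a submodule of a free module -/

section Rees

variable {R : Type*} [CommRing R] {n : ℕ}

/-- The ideal of `S_R(M)` defining the Rees algebra of `M ⊆ R^n`: the kernel of
`S_R(M) → S_R(R^n)`. Over a domain this is the `R`-torsion of `S_R(M)`, see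
`mem_reesIdeal_iff`. Unlike torsion, this kernel is functorial in `R`. -/
def reesIdeal (M : Submodule R (Fin n → R)) : Ideal (SymmetricAlgebra R M) :=
  RingHom.ker (symMap (RingHom.id R) M.subtype)

/-- The Rees algebra of a submodule `M ⊆ R^n`. -/
abbrev ReesAlgebra (M : Submodule R (Fin n → R)) : Type _ :=
  SymmetricAlgebra R M ⧸ reesIdeal M

end Rees

section Torsion

open Polynomial

/-- The ring map `S_R(M) → S_R(M)[X]` sending a form `z` of degree `i` to `z X^i`. -/
def homogenize (R M : Type*) [CommRing R] [AddCommGroup M] [Module R M] :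
    SymmetricAlgebra R M →ₐ[R] (SymmetricAlgebra R M)[X] :=
  SymmetricAlgebra.lift
    { toFun := fun x => C (SymmetricAlgebra.ι R M x) * X
      map_add' := fun x y => by rw [map_add, map_add, add_mul]
      map_smul' := fun c x => by
        rw [map_smul, RingHom.id_apply, ← smul_C, smul_mul_assoc] }

theorem homogenize_ι {R M : Type*} [CommRing R] [AddCommGroup M] [Module R M] (x : M) :
    homogenize R M (SymmetricAlgebra.ι R M x) = C (SymmetricAlgebra.ι R M x) * X :=
  SymmetricAlgebra.lift_ι_apply _ x

theorem homogenize_algebraMap {R M : Type*} [CommRing R] [AddCommGroup M] [Module R M] (c : R) :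
    homogenize R M (algebraMap R _ c) = C (algebraMap R _ c) :=
  AlgHom.commutes _ c

/-- If `u : M' → M` satisfies `u ∘ g = s`, every element of the kernel of `S(g)` is killed by a
power of `s`. -/
theorem exists_pow_smul_eq_zero {R M M' : Type*} [CommRing R] [AddCommGroup M] [Module R M]
    [AddCommGroup M'] [Module R M'] (g : M →ₗ[R] M') (u : M' →ₗ[R] M) (s : R)
    (hu : ∀ x, u (g x) = s • x) (z : SymmetricAlgebra R M)
    (hz : symMap (RingHom.id R) g z = 0) : ∃ N : ℕ, s ^ N • z = 0 := by
  have e1 : (mapRingHom (symMap (RingHom.id R) u)).comp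
      ((homogenize R M').toRingHom.comp (symMap (RingHom.id R) g)) =
      (compRingHom (C (algebraMap R (SymmetricAlgebra R M) s) * X)).comp
        (homogenize R M).toRingHom := by
    refine symHom_ext (fun c => ?_) (fun x => ?_)
    · simp [symMap_algebraMap]
    · simp [symMap_ι, homogenize_ι, hu, Algebra.smul_def, mul_assoc, mul_left_comm]
  have e2 : (evalRingHom 1).comp (homogenize R M).toRingHom = RingHom.id _ := by
    refine symHom_ext (fun c => ?_) (fun x => ?_)
    · simp
    · simp [homogenize_ι]
  have h1 : (homogenize R M z).comp (C (algebraMap R (SymmetricAlgebra R M) s) * X) = 0 := by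
    have := RingHom.congr_fun e1 z
    simp only [RingHom.comp_apply, hz, map_zero] at this
    exact this.symm
  have h2 : (homogenize R M z).eval 1 = z := RingHom.congr_fun e2 z
  refine ⟨(homogenize R M z).natDegree, ?_⟩
  generalize homogenize R M z = P at h1 h2
  rw [← h2, eval_eq_sum_range, Finset.smul_sum]
  refine Finset.sum_eq_zero fun i hi => ?_
  have h3 := congrArg (fun P => P.coeff i) h1
  simp only [comp_C_mul_X_coeff, coeff_zero] at h3
  rw [one_pow, mul_one, Algebra.smul_def, map_pow,
    ← Nat.sub_add_cancel (Nat.lt_succ_iff.1 (Finset.mem_range.1 hi)), pow_add, mul_assoc,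
    mul_comm (_ ^ i), h3, mul_zero]

theorem exists_retraction_up_to_scalar {R : Type*} (K : Type*) [CommRing R] [IsDomain R] [Field K]
    [Algebra R K] [IsFractionRing R K] {n : ℕ}
    (M : Submodule R (Fin n → R)) :
    ∃ (s : R) (u : (Fin n → R) →ₗ[R] M), s ≠ 0 ∧ ∀ x : M, u x = s • x := by
  classical
  let c : (Fin n → R) →ₗ[R] (Fin n → K) := (Algebra.linearMap R K).compLeft (Fin n)
  have hsm : ∀ (a : R) (y : K), a • y = algebraMap R K a * y := fun a y => Algebra.smul_def a y
  have hc : Function.Injective c := fun x y h => by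
    ext i
    exact IsFractionRing.injective R K (congrFun h i)
  let V : Submodule K (Fin n → K) := Submodule.span K (c '' M)
  obtain ⟨ρ, hρ⟩ := LinearMap.exists_leftInverse_of_injective V.subtype
    (LinearMap.ker_eq_bot.2 V.injective_subtype)
  have hV : ∀ v ∈ V, ∃ (s : R) (m : M), s ≠ 0 ∧ s • v = c m := by
    intro v hv
    induction hv using Submodule.span_induction with
    | mem v hv =>
      obtain ⟨m, hm, rfl⟩ := hv
      exact ⟨1, ⟨m, hm⟩, one_ne_zero, one_smul _ _⟩
    | zero => exact ⟨1, 0, one_ne_zero, by simp⟩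
    | add v w _ _ hv hw =>
      obtain ⟨s, m, hs, hm⟩ := hv
      obtain ⟨t, l, ht, hl⟩ := hw
      refine ⟨s * t, t • m + s • l, mul_ne_zero hs ht, ?_⟩
      rw [smul_add, mul_comm, mul_smul, hm, mul_comm, mul_smul, hl]
      simp
    | smul a v _ hv =>
      obtain ⟨s, m, hs, hm⟩ := hv
      obtain ⟨b, t, ht, rfl⟩ := IsFractionRing.div_surjective (A := R) a
      have ht0 : t ≠ 0 := nonZeroDivisors.ne_zero ht
      have ht' : algebraMap R K t ≠ 0 := by
        simpa using ht0
      refine ⟨t * s, b • m, mul_ne_zero ht0 hs, ?_⟩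
      have : c ((b • m : M) : Fin n → R) = b • c m := by simp
      rw [this, ← hm]
      ext i
      simp only [Pi.smul_apply, smul_eq_mul, hsm, map_mul]
      field_simp
  choose s m hs hm using fun j => hV _ (ρ (Pi.single j 1)).2
  refine ⟨∏ j, s j, ∑ j, (LinearMap.proj j).smulRight ((∏ i ∈ Finset.univ.erase j, s i) • m j),
    Finset.prod_ne_zero_iff.2 fun j _ => hs j, fun x => ?_⟩
  apply Subtype.ext
  apply hc
  have hx : c x = ∑ j, algebraMap R K ((x : Fin n → R) j) • (Pi.single j (1 : K) : Fin n → K) := by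
    ext i
    simp [c, Finset.sum_apply, Pi.single_apply, hsm]
  have hx2 : (ρ (c x) : Fin n → K) = c x := by
    have : c x ∈ V := Submodule.subset_span ⟨x, x.2, rfl⟩
    exact congrArg Subtype.val (LinearMap.congr_fun hρ ⟨c x, this⟩)
  have h4 : c ((∏ j, s j) • x : M) = (∏ j, s j) • c x := by simp
  rw [h4, ← hx2, hx, map_sum]
  simp only [LinearMap.sum_apply, LinearMap.smulRight_apply, LinearMap.proj_apply, map_smul,
    Submodule.coe_sum, Submodule.coe_smul, map_sum, Finset.smul_sum, ← hm]
  refine Finset.sum_congr rfl fun j _ => ?_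
  rw [← Finset.mul_prod_erase Finset.univ s (Finset.mem_univ j)]
  ext i
  simp only [Pi.smul_apply, smul_eq_mul, hsm, map_mul]
  ring

/-- Over a domain the Rees ideal is exactly the `R`-torsion of the symmetric algebra. -/
theorem mem_reesIdeal_iff {R : Type*} [CommRing R] [IsDomain R] {n : ℕ}
    (M : Submodule R (Fin n → R)) (z : SymmetricAlgebra R M) :
    z ∈ reesIdeal M ↔ z ∈ Submodule.torsion R (SymmetricAlgebra R M) := by
  rw [Submodule.mem_torsion_iff]
  constructor
  · intro hz
    obtain ⟨s, u, hs, hu⟩ := exists_retraction_up_to_scalar (FractionRing R) M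
    obtain ⟨N, hN⟩ := exists_pow_smul_eq_zero M.subtype u s hu z hz
    exact ⟨⟨s ^ N, mem_nonZeroDivisors_of_ne_zero (pow_ne_zero N hs)⟩, hN⟩
  · rintro ⟨⟨a, ha⟩, h⟩
    have h' : a • z = 0 := h
    have h2 := congrArg (symMap (RingHom.id R) M.subtype) h'
    rw [Algebra.smul_def, map_mul, symMap_algebraMap, map_zero, mul_eq_zero] at h2
    refine h2.resolve_left fun h3 => nonZeroDivisors.ne_zero ha ?_
    simpa using h3

end Torsion

/-! ### The deformation of an embedded module, and the embedded Aluffi algebra -/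

section Embedded

variable {R A : Type*} [CommRing R] [CommRing A] {n : ℕ}

/-- The map `R^n → A^n` applying `f` to every coordinate; for surjective `f` with kernel `J` it is
a surjection with kernel `J R^n`, i.e. compatible with `f`. -/
def coordMap (f : R →+* A) (n : ℕ) : (Fin n → R) →ₛₗ[f] (Fin n → A) where
  toFun x := fun i => f (x i)
  map_add' x y := by ext i; simp
  map_smul' c x := by ext i; simp

/-- The torsionfree deformation of `N ⊆ A^n` to `R`: its full preimage under `R^n → A^n`. -/
def deformation (f : R →+* A) (N : Submodule A (Fin n → A)) : Submodule R (Fin n → R) :=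
  N.comap (coordMap f n)

/-- The structural map from the deformation of `N` to `N`. -/
def deformationMap (f : R →+* A) (N : Submodule A (Fin n → A)) :
    deformation f N →ₛₗ[f] N where
  toFun x := ⟨coordMap f n x, x.2⟩
  map_add' x y := by ext i; simp
  map_smul' c x := by ext i; simp [coordMap]

/-- The ideal `T · S_A(N)`, where `T` is the Rees ideal of the deformation of `N` to `R`. -/
def aluffiIdeal (f : R →+* A) (N : Submodule A (Fin n → A)) : Ideal (SymmetricAlgebra A N) :=
  (reesIdeal (deformation f N)).map (symMap f (deformationMap f N))

/-- The `R`-embedded Aluffi algebra `S_A(N) ⊗_{S_R(M)} Rees_R(M)` of `N ⊆ A^n`, with `M` the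
deformation of `N` to `R`. As `Rees_R(M) = S_R(M)/T`, this tensor product is `S_A(N)/T S_A(N)`;
see `embeddedAluffiEquiv`. -/
abbrev EmbeddedAluffi (f : R →+* A) (N : Submodule A (Fin n → A)) : Type _ :=
  SymmetricAlgebra A N ⧸ aluffiIdeal f N

theorem embeddedAluffiEquiv (f : R →+* A) (N : Submodule A (Fin n → A)) :
    let _ : Algebra (SymmetricAlgebra R (deformation f N)) (SymmetricAlgebra A N) :=
      (symMap f (deformationMap f N)).toAlgebra
    Nonempty (EmbeddedAluffi f N ≃ₐ[SymmetricAlgebra A N]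
      TensorProduct (SymmetricAlgebra R (deformation f N)) (SymmetricAlgebra A N)
        (ReesAlgebra (deformation f N))) := by
  intro _
  exact ⟨Algebra.TensorProduct.quotIdealMapEquivTensorQuot (SymmetricAlgebra A N)
    (reesIdeal (deformation f N))⟩

/-- A homomorphism `h : R → R'` over `A` induces a map of embedded Aluffi algebras. -/
theorem aluffiIdeal_le {R' : Type*} [CommRing R'] (f : R →+* A) (f' : R' →+* A) (h : R →+* R')
    (hh : f'.comp h = f) (N : Submodule A (Fin n → A)) :
    aluffiIdeal f N ≤ aluffiIdeal f' N := by
  subst hh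
  let e : deformation (f'.comp h) N →ₛₗ[h] deformation f' N :=
    { toFun := fun x => ⟨coordMap h n x, x.2⟩
      map_add' := fun x y => by ext i; simp
      map_smul' := fun c x => by ext i; simp [coordMap] }
  have h1 : (symMap f' (deformationMap f' N)).comp (symMap h e) =
      symMap (f'.comp h) (deformationMap (f'.comp h) N) := by
    refine symHom_ext (fun c => ?_) (fun x => ?_)
    · simp [symMap_algebraMap]
    · simp only [RingHom.comp_apply, symMap_ι]; rfl
  have h2 : (symMap (RingHom.id R') (deformation f' N).subtype).comp (symMap h e) =
      (symMap h (coordMap h n)).comp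
        (symMap (RingHom.id R) (deformation (f'.comp h) N).subtype) := by
    refine symHom_ext (fun c => ?_) (fun x => ?_)
    · simp [symMap_algebraMap]
    · simp only [RingHom.comp_apply, symMap_ι]; rfl
  refine Ideal.map_le_iff_le_comap.2 fun z hz => ?_
  rw [Ideal.mem_comap, ← h1, RingHom.comp_apply]
  refine Ideal.mem_map_of_mem _ ?_
  have hz' : symMap (RingHom.id R) (deformation (f'.comp h) N).subtype z = 0 := hz
  change symMap (RingHom.id R') (deformation f' N).subtype (symMap h e z) = 0
  rw [← RingHom.comp_apply, h2, RingHom.comp_apply, hz', map_zero]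

end Embedded

/-! ### The absolute Aluffi algebra -/

universe u v

/-- A `k`-algebra of finite type `R` together with a surjection of `k`-algebras `R → A`. -/
structure Ambient (k : Type u) [Field k] (A : Type v) [CommRing A] [Algebra k A] where
  carrier : Type u
  [commRing : CommRing carrier]
  [algebra : Algebra k carrier]
  [finiteType : Algebra.FiniteType k carrier]
  hom : carrier →ₐ[k] A
  surjective : Function.Surjective hom

attribute [instance] Ambient.commRing Ambient.algebra Ambient.finiteType

section Absolute

variable (k : Type u) [Field k] {A : Type v} [CommRing A] [Algebra k A] {n : ℕ}

/-- The (absolute) Aluffi algebra of `N ⊆ A^n`: the inverse limit of the embedded Aluffi algebras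
over all `k`-algebras of finite type mapping onto `A`, with transition maps induced by the
surjective `k`-algebra maps over `A`. -/
def aluffiAlgebra (N : Submodule A (Fin n → A)) :
    Subring (∀ i : Ambient k A, EmbeddedAluffi i.hom.toRingHom N) where
  carrier := {x | ∀ (i j : Ambient k A) (h : i.carrier →ₐ[k] j.carrier),
    Function.Surjective h → ∀ hh : j.hom.toRingHom.comp h.toRingHom = i.hom.toRingHom,
      Ideal.Quotient.factor (aluffiIdeal_le _ _ h.toRingHom hh N) (x i) = x j}
  mul_mem' := fun hx hy i j h hs hh => by
    simp only [Pi.mul_apply, map_mul, hx i j h hs hh, hy i j h hs hh]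
  one_mem' := fun i j h hs hh => by simp only [Pi.one_apply, map_one]
  add_mem' := fun hx hy i j h hs hh => by
    simp only [Pi.add_apply, map_add, hx i j h hs hh, hy i j h hs hh]
  zero_mem' := fun i j h hs hh => by simp only [Pi.zero_apply, map_zero]
  neg_mem' := fun hx i j h hs hh => by
    simp only [Pi.neg_apply, map_neg, hx i j h hs hh]

end Absolute

end

end ModuleAluffi

namespace ModuleAluffi

/-! ### Dimension of affine domains -/

section Dimension

open Cardinal

/-! Let `N ⊆ A^n` be the image of `E/τ(E)` and let `M ⊆ R^n` be its preimage. The inverse limit is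
first replaced by the single embedded algebra attached to `R`, and its dimension is then estimated
through its quotients by primes, which are affine domains, so that dimension is transcendence degree
(`ringKrullDim_eq_tdim`).

Limit. A polynomial ring over `k` with a surjection to `A` maps to every ambient ring over `A`, so
its Aluffi ideal is the smallest one; any ambient ring and a given polynomial ring are dominated by
a common polynomial ring. Hence the limit is the value at a polynomial ring
(`aluffiAlgebra_equiv_of_polynomial`). To pass from a polynomial ring `P` to its smooth quotient `R
= P/K`, one would like a section `R → P`. Smoothness only gives sections `R → P/K^t`, but Artin–Rees
shows that one large `t` suffices for each relation (`aluffiIdeal_eq_of_formallySmooth`).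

Bound `d+n+g`. The algebra is a quotient of the Rees algebra of `M`, a subring of `R[X_1,…,X_n]`, so
its dimension is locally at most `e+n`, where `e` is the relative dimension of `R`. Near a prime
containing `J`, the dimension formula at a minimal prime of `J` gives `e ≤ d+g`
(`exists_smooth_dimension`).

Bound by the Fitting defect. Let `D` be a domain quotient lying over a prime `p` of `A`. It is
generated by `m` elements subject to the columns of the presentation matrix. If `ρ` is the largest
size of a minor outside `p`, Cramer's rule leaves at most `m-ρ` independent generators, so `dim D ≤
dim A/p + m-ρ`. Combine this with `ht p + dim A/p ≤ d`, with `m ≤ rk + r`, and with `ht p ≥ ht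
I_{ρ+1}` when `ρ < rk`.

Lower bound. The algebra maps to the Rees algebra of `N` over `A`. At a minimal prime `p`, that
algebra maps to a polynomial ring in `r` variables over `Frac(A/p)` with all variables in the image,
and `dim A/p = d`. -/

theorem ringKrullDim_eq_of_isIntegral (R S : Type*) [CommRing R] [CommRing S] [Algebra R S]
    [Algebra.IsIntegral R S] (hinj : Function.Injective (algebraMap R S)) :
    ringKrullDim S = ringKrullDim R := by
  apply le_antisymm
  · exact Order.krullDim_le_of_strictMono (PrimeSpectrum.comap (algebraMap R S))
      fun I J h => Ideal.IsIntegral.comap_lt_comap (R := R) h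
  · refine iSup_le fun l => ?_
    obtain ⟨Q, hQ, h⟩ := Ideal.exists_ideal_over_prime_of_isIntegral (S := S) l.head.asIdeal ⊥
      (by rw [← RingHom.ker_eq_comap_bot, (RingHom.injective_iff_ker_eq_bot _).1 hinj]; exact bot_le)
    have : Q.IsPrime := h.1
    have : Q.LiesOver l.head.asIdeal := ⟨h.2.symm⟩
    obtain ⟨L, hL, -⟩ := Ideal.exists_ltSeries_of_hasGoingUp l Q
    rw [← hL]
    exact Order.LTSeries.length_le_krullDim L

/-- The transcendence degree as a natural number. -/
noncomputable def tdim (k D : Type*) [CommRing k] [CommRing D] [Algebra k D] : ℕ :=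
  toNat (Algebra.trdeg k D)

/-! ### Transcendence degree of finitely generated algebras. -/

section tdim

variable (k D D' : Type*) [CommRing k] [IsDomain k] [CommRing D] [CommRing D'] [Algebra k D]
  [Algebra k D']

variable {D D'} in
-- Finite type excludes an infinite transcendence degree, which `toNat` would send to `0`; the same
-- hypothesis plays this role in the comparisons below.
theorem tdim_le_of_injective [Algebra.FiniteType k D'] (f : D →ₐ[k] D')
    (hf : Function.Injective f) : tdim k D ≤ tdim k D' := by
  rw [tdim, tdim, ← toNat_lift (Algebra.trdeg k D), ← toNat_lift (Algebra.trdeg k D')]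
  exact toNat_le_toNat (lift_trdeg_le_of_injective f hf)
    (lift_lt_aleph0.2 trdeg_lt_aleph0_of_finiteType)

theorem tdim_add_eq [IsDomain D'] [Algebra D D'] [IsScalarTower k D D']
    [Algebra.FiniteType k D] [Algebra.FiniteType k D']
    (h1 : Function.Injective (algebraMap k D)) (h2 : Function.Injective (algebraMap D D')) :
    tdim k D' = tdim k D + tdim D D' := by
  have := (faithfulSMul_iff_algebraMap_injective k D).2 h1
  have := (faithfulSMul_iff_algebraMap_injective D D').2 h2
  have : IsDomain D := h2.isDomain (algebraMap D D')
  have : Algebra.FiniteType D D' := .of_restrictScalars_finiteType k D D'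
  have h := congrArg toNat (lift_trdeg_add_eq k D D')
  rw [toNat_add (lift_lt_aleph0.2 trdeg_lt_aleph0_of_finiteType)
    (lift_lt_aleph0.2 trdeg_lt_aleph0_of_finiteType), toNat_lift, toNat_lift,
    toNat_lift] at h
  exact h.symm

theorem tdim_mvPolynomial (ι : Type*) : tdim k (MvPolynomial ι k) = Nat.card ι := by
  simp [tdim, Nat.card]

theorem tdim_polynomial : tdim k (Polynomial k) = 1 := by
  simp [tdim]

theorem le_tdim_of_algebraicIndependent [Algebra.FiniteType k D] {ι : Type*} [Finite ι] {x : ι → D}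
    (hx : AlgebraicIndependent k x) : Nat.card ι ≤ tdim k D := by
  have h := hx.lift_cardinalMk_le_trdeg
  have := toNat_le_toNat h (lift_lt_aleph0.2 trdeg_lt_aleph0_of_finiteType)
  rwa [toNat_lift, toNat_lift] at this

omit [IsDomain k] in
theorem tdim_le_ncard_of_isAlgebraic [NoZeroDivisors D] (s : Set D) (hs : s.Finite)
    [Algebra.IsAlgebraic (Algebra.adjoin k s) D] : tdim k D ≤ s.ncard := by
  have h := Algebra.IsAlgebraic.trdeg_le_cardinalMk k s
  exact toNat_le_toNat h (lt_aleph0_iff_set_finite.2 hs)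

end tdim

/-- Noether normalization: an integral extension changes neither the dimension nor the transcendence
degree, and both are known for a polynomial ring. -/
theorem ringKrullDim_eq_tdim (k D : Type*) [Field k] [CommRing D] [IsDomain D] [Algebra k D]
    [Algebra.FiniteType k D] : ringKrullDim D = tdim k D := by
  obtain ⟨s, g, hg, hint⟩ := exists_integral_inj_algHom_of_fg k D
  algebraize [g.toRingHom]
  have : IsScalarTower k (MvPolynomial (Fin s) k) D :=
    .of_algebraMap_eq fun x => (g.commutes x).symm
  have hinj : Function.Injective (algebraMap (MvPolynomial (Fin s) k) D) := hg
  rw [ringKrullDim_eq_of_isIntegral (MvPolynomial (Fin s) k) D hinj,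
    tdim_add_eq k (MvPolynomial (Fin s) k) D (algebraMap k _).injective hinj, tdim_mvPolynomial,
    MvPolynomial.ringKrullDim_of_isNoetherianRing, ringKrullDim_eq_zero_of_field]
  have : tdim (MvPolynomial (Fin s) k) D = 0 := by
    have := (faithfulSMul_iff_algebraMap_injective (MvPolynomial (Fin s) k) D).2 hinj
    rw [tdim, trdeg_eq_zero, map_zero]
  simp [this]

/-- A chain of primes lives in the quotient by its smallest member. This reduces upper bounds to
domains, and no nontriviality of `B` is needed. -/
theorem ringKrullDim_le_of_forall_quotient_le {B : Type*} [CommRing B] (c : WithBot ℕ∞)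
    (h : ∀ (Q : Ideal B) [Q.IsPrime], ringKrullDim (B ⧸ Q) ≤ c) : ringKrullDim B ≤ c := by
  refine iSup_le fun l => ?_
  refine le_trans ?_ (h l.head.asIdeal)
  rw [ringKrullDim_quotient]
  let l' : LTSeries (PrimeSpectrum.zeroLocus (R := B) l.head.asIdeal) :=
    { length := l.length
      toFun := fun i => ⟨l i, (LTSeries.head_le l i : l.head ≤ l i)⟩
      step := fun i => l.step i }
  exact Order.LTSeries.length_le_krullDim l'

theorem height_add_ringKrullDim_quotient_le {A : Type*} [CommRing A] (p : Ideal A) [p.IsPrime] :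
    (p.height : WithBot ℕ∞) + ringKrullDim (A ⧸ p) ≤ ringKrullDim A := by
  have h1 : ringKrullDim (A ⧸ p) = (Order.coheight (⟨p, inferInstance⟩ : PrimeSpectrum A)) := by
    rw [ringKrullDim_quotient, Order.coheight_eq_krullDim_Ici]
    rfl
  have : Nonempty (PrimeSpectrum A) := ⟨⟨p, inferInstance⟩⟩
  rw [h1, show p.height = Order.height (⟨p, inferInstance⟩ : PrimeSpectrum A) from
    PrimeSpectrum.height_eq_orderHeight ⟨p, inferInstance⟩, ringKrullDim,
    Order.krullDim_eq_iSup_height_add_coheight_of_nonempty]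
  exact WithBot.coe_le_coe.2
    (le_iSup (fun a : PrimeSpectrum A => Order.height a + Order.coheight a) ⟨p, inferInstance⟩)

end Dimension

end ModuleAluffi

namespace ModuleAluffi

/-! ### The dimension formula for smooth algebras -/

section SmoothDimension

open Cardinal Polynomial

theorem tdim_le_of_surjective {k D D' : Type*} [CommRing k] [IsDomain k] [CommRing D] [CommRing D']
    [Algebra k D] [Algebra k D'] [Algebra.FiniteType k D] (f : D →ₐ[k] D')
    (hf : Function.Surjective f) : tdim k D' ≤ tdim k D := by
  rw [tdim, tdim, ← toNat_lift (Algebra.trdeg k D), ← toNat_lift (Algebra.trdeg k D')]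
  exact toNat_le_toNat (lift_trdeg_le_of_surjective f hf)
    (lift_lt_aleph0.2 trdeg_lt_aleph0_of_finiteType)

theorem tdim_eq_of_isAlgebraic {k D D' : Type*} [CommRing k] [IsDomain k] [CommRing D]
    [CommRing D'] [IsDomain D'] [Algebra k D] [Algebra k D'] [Algebra D D'] [IsScalarTower k D D']
    [Algebra.FiniteType k D] [Algebra.FiniteType k D'] [Algebra.IsAlgebraic D D']
    (h1 : Function.Injective (algebraMap k D)) (h2 : Function.Injective (algebraMap D D')) :
    tdim k D' = tdim k D := by
  rw [tdim_add_eq k D D' h1 h2, tdim, tdim, trdeg_eq_zero (R := D), map_zero, add_zero]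

/-- Either `P` is the extension of its contraction, and the residue domain gains a variable, or `P`
is strictly larger than that extension, and the height grows by one. Going down shows that extension
does not lower the height. -/
theorem height_add_tdim_succ_le {k S : Type*} [Field k] [CommRing S] [Algebra k S]
    [Algebra.FiniteType k S] (P : Ideal S[X]) [P.IsPrime] :
    (P.comap C).height + tdim k (S ⧸ P.comap C) + 1 ≤ P.height + tdim k (S[X] ⧸ P) := by
  have : IsNoetherianRing S := Algebra.FiniteType.isNoetherianRing k S
  set p := P.comap C with hp
  have hle : p.map C ≤ P := Ideal.map_comap_le
  have hpr : (p.map C).IsPrime := Ideal.isPrime_map_C_of_isPrime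
  have hover : (p.map C).LiesOver p := ⟨le_antisymm Ideal.le_comap_map (Ideal.comap_mono hle)⟩
  have hh : p.height ≤ (p.map C).height := by
    rw [Ideal.height_eq_height_add_of_liesOver_of_hasGoingDown p (p.map C)]
    exact le_self_add
  rcases hle.eq_or_lt with h | h
  · let e : (S ⧸ p)[X] →ₐ[k] S[X] ⧸ P :=
      { toRingHom := (Ideal.Quotient.factor h.le).comp
          (Ideal.polynomialQuotientEquivQuotientPolynomial p).toRingHom
        commutes' := fun c => by
          have : algebraMap k (S ⧸ p)[X] c =
              (C (algebraMap k S c)).map (Ideal.Quotient.mk p) := by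
            rw [Polynomial.algebraMap_apply, Polynomial.map_C]
            rfl
          simp only [RingHom.toMonoidHom_eq_coe, OneHom.toFun_eq_coe, MonoidHom.toOneHom_coe,
            MonoidHom.coe_coe, this, RingHom.comp_apply]
          erw [Ideal.polynomialQuotientEquivQuotientPolynomial_map_mk]
          rfl }
    have he : Function.Injective e := by
      have : Function.Injective (Ideal.Quotient.factor h.le) := by
        rw [RingHom.injective_iff_ker_eq_bot, Ideal.Quotient.factor_ker, ← h]
        simp
      exact this.comp (Ideal.polynomialQuotientEquivQuotientPolynomial p).injective
    have h1 := tdim_le_of_injective k e he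
    rw [tdim_add_eq k (S ⧸ p) (S ⧸ p)[X] (algebraMap k _).injective C_injective,
      tdim_polynomial] at h1
    rw [add_assoc]
    refine add_le_add (hh.trans (Ideal.height_mono hle)) ?_
    exact_mod_cast h1
  · have h1 : p.height + 1 ≤ P.height :=
      (add_le_add_left hh 1).trans (Ideal.height_add_one_le_of_lt_of_isPrime h)
    let e : S ⧸ p →ₐ[k] S[X] ⧸ P := Ideal.quotientMapₐ P CAlgHom le_rfl
    have he : Function.Injective e := Ideal.quotientMap_injective (f := C) (I := P)
    have h2 := tdim_le_of_injective k e he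
    rw [add_right_comm]
    refine add_le_add h1 ?_
    exact_mod_cast h2

theorem le_height_add_tdim_mvPolynomial (k : Type*) [Field k] (e : ℕ)
    (p : Ideal (MvPolynomial (Fin e) k)) [p.IsPrime] :
    (e : ℕ∞) ≤ p.height + tdim k (MvPolynomial (Fin e) k ⧸ p) := by
  induction e with
  | zero => simp
  | succ e ih =>
    let E : (MvPolynomial (Fin e) k)[X] ≃ₐ[k] MvPolynomial (Fin (e + 1)) k :=
      (MvPolynomial.finSuccEquiv k e).symm
    let P : Ideal (MvPolynomial (Fin e) k)[X] := p.comap E.toAlgHom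
    have hP : P.height = p.height := RingEquiv.height_comap E.toRingEquiv p
    have h1 := height_add_tdim_succ_le (k := k) P
    have h2 : tdim k ((MvPolynomial (Fin e) k)[X] ⧸ P) ≤ tdim k (MvPolynomial (Fin (e + 1)) k ⧸ p) :=
      tdim_le_of_injective k (Ideal.quotientMapₐ p E.toAlgHom le_rfl)
        (Ideal.quotientMap_injective (f := E.toAlgHom.toRingHom) (I := p))
    calc ((e + 1 : ℕ) : ℕ∞) = e + 1 := by push_cast; rfl
      _ ≤ _ + 1 := add_le_add_left (ih (P.comap C)) 1
      _ ≤ _ := h1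
      _ ≤ _ := by
        rw [hP]
        gcongr

/-- The extension of fraction fields is formally unramified and essentially of finite type, hence
finite. -/
theorem isAlgebraic_of_formallyUnramified (D D' : Type*) [CommRing D] [CommRing D'] [IsDomain D']
    [Algebra D D'] (hinj : Function.Injective (algebraMap D D'))
    [Algebra.FormallyUnramified D D'] [Algebra.FiniteType D D'] : Algebra.IsAlgebraic D D' := by
  have : IsDomain D := hinj.isDomain (algebraMap D D')
  let K := FractionRing D
  let L := FractionRing D'
  have := (faithfulSMul_iff_algebraMap_injective D D').2 hinj
  have : Algebra.FormallyUnramified D' L := .of_isLocalization (nonZeroDivisors D')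
  have : Algebra.FormallyUnramified D L := .comp D D' L
  let _ : Algebra K L := FractionRing.liftAlgebra D L
  have : Algebra.FormallyUnramified K L := .of_restrictScalars D K L
  have : Algebra.EssFiniteType D L := .comp D D' L
  have : Algebra.EssFiniteType K L := .of_comp D K L
  have : Module.Finite K L := Algebra.FormallyUnramified.finite_of_free K L
  have : Algebra.IsAlgebraic K L := inferInstance
  have : Algebra.IsAlgebraic D K := IsLocalization.isAlgebraic (R := D) (S := K) (nonZeroDivisors D)
  have : Algebra.IsAlgebraic D L := .trans D K L
  exact .of_injective (IsScalarTower.toAlgHom D D' L) (IsFractionRing.injective D' L)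

/-! ### Étale algebras over a polynomial ring. -/

section Etale

variable (k S : Type*) [Field k] [CommRing S] [Algebra k S] (e : ℕ)
  [Algebra (MvPolynomial (Fin e) k) S] [IsScalarTower k (MvPolynomial (Fin e) k) S]
  [Algebra.Etale (MvPolynomial (Fin e) k) S] (P : Ideal S) [P.IsPrime]

/-- The residue domains form an unramified extension of finite type, which is therefore algebraic.
-/
theorem tdim_quotient_eq_of_etale : tdim k (S ⧸ P) =
    tdim k (MvPolynomial (Fin e) k ⧸ P.under (MvPolynomial (Fin e) k)) := by
  set p := P.under (MvPolynomial (Fin e) k)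
  have hinj : Function.Injective (algebraMap (MvPolynomial (Fin e) k ⧸ p) (S ⧸ P)) :=
    FaithfulSMul.algebraMap_injective _ _
  have : Algebra.FiniteType k S := .trans (S := MvPolynomial (Fin e) k) inferInstance inferInstance
  have : Algebra.FormallyUnramified (MvPolynomial (Fin e) k) (S ⧸ P) :=
    .comp (MvPolynomial (Fin e) k) S (S ⧸ P)
  have : Algebra.FiniteType (MvPolynomial (Fin e) k) (S ⧸ P) := inferInstance
  have : Algebra.FormallyUnramified (MvPolynomial (Fin e) k ⧸ p) (S ⧸ P) :=
    .of_restrictScalars (MvPolynomial (Fin e) k) (MvPolynomial (Fin e) k ⧸ p) (S ⧸ P)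
  have : Algebra.FiniteType (MvPolynomial (Fin e) k ⧸ p) (S ⧸ P) :=
    .of_restrictScalars_finiteType (MvPolynomial (Fin e) k) (MvPolynomial (Fin e) k ⧸ p) (S ⧸ P)
  have := isAlgebraic_of_formallyUnramified _ _ hinj
  have : IsScalarTower k (MvPolynomial (Fin e) k ⧸ p) (S ⧸ P) := by
    refine IsScalarTower.of_algebraMap_eq (R := k) (S := MvPolynomial (Fin e) k ⧸ p) (A := S ⧸ P)
      fun c => ?_
    rw [IsScalarTower.algebraMap_apply k (MvPolynomial (Fin e) k) (MvPolynomial (Fin e) k ⧸ p),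
      ← IsScalarTower.algebraMap_apply (MvPolynomial (Fin e) k) (MvPolynomial (Fin e) k ⧸ p),
      ← IsScalarTower.algebraMap_apply]
  exact tdim_eq_of_isAlgebraic (algebraMap k _).injective hinj

theorem tdim_quotient_le_of_etale : tdim k (S ⧸ P) ≤ e := by
  rw [tdim_quotient_eq_of_etale k S e]
  refine (tdim_le_of_surjective (Ideal.Quotient.mkₐ k _) Ideal.Quotient.mk_surjective).trans ?_
  rw [tdim_mvPolynomial, Nat.card_fin]

theorem le_height_add_tdim_of_etale : (e : ℕ∞) ≤ P.height + tdim k (S ⧸ P) := by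
  rw [tdim_quotient_eq_of_etale k S e]
  refine (le_height_add_tdim_mvPolynomial k e (P.under _)).trans ?_
  gcongr
  have : IsNoetherianRing S := Algebra.FiniteType.isNoetherianRing (MvPolynomial (Fin e) k) S
  rw [Ideal.height_eq_height_add_of_liesOver_of_hasGoingDown (P.under (MvPolynomial (Fin e) k)) P]
  exact le_self_add

end Etale

/-- Some basic open neighbourhood of `P` is étale over an affine space of dimension `e`; primes
below `P` survive there with the same height and transcendence degree. As `R` need not be a domain,
`e` depends on `P`. -/
theorem exists_smooth_dimension (k R : Type*) [Field k] [CommRing R] [Algebra k R]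
    [Algebra.Smooth k R] (P : Ideal R) [P.IsPrime] : ∃ e : ℕ, ∀ P₀ : Ideal R, P₀.IsPrime → P₀ ≤ P →
      tdim k (R ⧸ P₀) ≤ e ∧ (e : ℕ∞) ≤ P₀.height + tdim k (R ⧸ P₀) := by
  obtain ⟨f, hf, hs⟩ := Algebra.IsSmoothAt.exists_notMem_isStandardSmooth k P
  let S := Localization.Away f
  obtain ⟨e, g, hg, het⟩ := RingHom.IsStandardSmooth.exists_etale_mvPolynomial
    ((RingHom.isStandardSmooth_algebraMap).2 hs)
  algebraize [g]
  have : IsScalarTower k (MvPolynomial (Fin e) k) S := .of_algebraMap_eq' hg.symm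
  refine ⟨e, fun P₀ hP₀ hle => ?_⟩
  have hdisj : Disjoint (Submonoid.powers f : Set R) P₀ := by
    rw [Set.disjoint_left]
    rintro x ⟨n, rfl⟩ hx
    exact hf (hle (hP₀.mem_of_pow_mem n hx))
  let Q : Ideal S := P₀.map (algebraMap R S)
  have hQ : Q.IsPrime := IsLocalization.isPrime_of_isPrime_disjoint (Submonoid.powers f) _ P₀ hP₀ hdisj
  have hunder : Q.comap (algebraMap R S) = P₀ :=
    IsLocalization.under_map_of_isPrime_disjoint (Submonoid.powers f) S hP₀ hdisj
  have hover : Q.LiesOver P₀ := ⟨hunder.symm⟩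
  have hheight : Q.height = P₀.height := by
    rw [← hunder]
    exact (IsLocalization.height_under (Submonoid.powers f) Q).symm
  have : Algebra.FiniteType k S := .trans (S := R) inferInstance inferInstance
  have hinj : Function.Injective (algebraMap (R ⧸ P₀) (S ⧸ Q)) :=
    FaithfulSMul.algebraMap_injective _ _
  have : Algebra.IsAlgebraic (R ⧸ P₀) (S ⧸ Q) := by
    refine ⟨fun x => ?_⟩
    obtain ⟨s, rfl⟩ := Ideal.Quotient.mk_surjective x
    obtain ⟨n, r, hr⟩ := IsLocalization.Away.surj f s
    refine ⟨C (Ideal.Quotient.mk P₀ (f ^ n)) * X - C (Ideal.Quotient.mk P₀ r), fun h => ?_, ?_⟩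
    · have := congrArg (fun q => q.coeff 1) h
      simp only [coeff_sub, coeff_C_mul, coeff_X_one, mul_one, coeff_C_succ, sub_zero, coeff_zero,
        Ideal.Quotient.eq_zero_iff_mem] at this
      exact hf (hle (hP₀.mem_of_pow_mem n this))
    · have h1 : ∀ a : R, algebraMap (R ⧸ P₀) (S ⧸ Q) (Ideal.Quotient.mk P₀ a) =
          Ideal.Quotient.mk Q (algebraMap R S a) := fun a => rfl
      rw [map_sub, map_mul, aeval_C, aeval_C, aeval_X, h1, h1, ← map_mul, map_pow, mul_comm,
        hr, sub_self]
  have : IsScalarTower k (R ⧸ P₀) (S ⧸ Q) := by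
    refine .of_algebraMap_eq fun c => ?_
    rw [IsScalarTower.algebraMap_apply k R (R ⧸ P₀),
      ← IsScalarTower.algebraMap_apply R (R ⧸ P₀), ← IsScalarTower.algebraMap_apply]
  have htdim : tdim k (S ⧸ Q) = tdim k (R ⧸ P₀) :=
    tdim_eq_of_isAlgebraic (algebraMap k _).injective hinj
  rw [← htdim, ← hheight]
  exact ⟨tdim_quotient_le_of_etale k S e Q, le_height_add_tdim_of_etale k S e Q⟩

end SmoothDimension

end ModuleAluffi

namespace ModuleAluffi

/-! ### The Rees algebra as a subring of a polynomial ring -/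

section ReesMap

open MvPolynomial

/-- The linear form `∑ x_i X_i` attached to a vector `x`. -/
noncomputable def linForm (R : Type*) [CommRing R] (n : ℕ) :
    (Fin n → R) →ₗ[R] MvPolynomial (Fin n) R :=
  (Pi.basisFun R (Fin n)).constr R X

theorem linForm_apply {R : Type*} [CommRing R] {n : ℕ} (x : Fin n → R) :
    linForm R n x = ∑ i, C (x i) * X i := by
  simp [linForm, Module.Basis.constr_apply_fintype, MvPolynomial.smul_eq_C_mul]

/-- The map `S_R(M) → R[X_1, …, X_n]` whose image is the Rees algebra. -/
noncomputable def reesMap {R : Type*} [CommRing R] {n : ℕ} (M : Submodule R (Fin n → R)) :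
    SymmetricAlgebra R M →ₐ[R] MvPolynomial (Fin n) R :=
  SymmetricAlgebra.lift ((linForm R n).comp M.subtype)

theorem reesMap_ι {R : Type*} [CommRing R] {n : ℕ} (M : Submodule R (Fin n → R)) (x : M) :
    reesMap M (SymmetricAlgebra.ι R M x) = linForm R n x :=
  SymmetricAlgebra.lift_ι_apply _ x

/-- The symmetric algebra of `R^n` is a polynomial ring. In this form Rees relations can be tested
on coefficients, as Artin–Rees requires. -/
theorem mem_reesIdeal_iff_reesMap {R : Type*} [CommRing R] {n : ℕ} (M : Submodule R (Fin n → R))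
    (z : SymmetricAlgebra R M) : z ∈ reesIdeal M ↔ reesMap M z = 0 := by
  let e := SymmetricAlgebra.equivMvPolynomial (Pi.basisFun R (Fin n))
  have h : (e : _ →+* _).comp (symMap (RingHom.id R) M.subtype) = (reesMap M).toRingHom := by
    refine symHom_ext (fun c => ?_) fun x => ?_
    · simp [symMap_algebraMap]
    · simp only [RingHom.comp_apply, symMap_ι]
      exact (SymmetricAlgebra.lift_ι_apply _ _).trans (reesMap_ι M x).symm
  have hz : e (symMap (RingHom.id R) M.subtype z) = reesMap M z := RingHom.congr_fun h z
  rw [← hz, map_eq_zero_iff e e.injective]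
  rfl

variable {R R' A : Type*} [CommRing R] [CommRing R'] [CommRing A] {n : ℕ}

/-- A ring map `h : R → R'` over `A` maps the deformation to `R` to the deformation to `R'`. -/
def deformationTransport {f : R →+* A} (f' : R' →+* A) (h : R →+* R') (hh : f'.comp h = f)
    (N : Submodule A (Fin n → A)) : deformation f N →ₛₗ[h] deformation f' N where
  toFun x := ⟨coordMap h n x, by subst hh; exact x.2⟩
  map_add' x y := by ext i; simp
  map_smul' c x := by ext i; simp [coordMap]

theorem symMap_deformationTransport {f : R →+* A} (f' : R' →+* A) (h : R →+* R')
    (hh : f'.comp h = f) (N : Submodule A (Fin n → A)) (z : SymmetricAlgebra R (deformation f N)) :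
    symMap f' (deformationMap f' N) (symMap h (deformationTransport f' h hh N) z) =
      symMap f (deformationMap f N) z := by
  subst hh
  have h1 : (symMap f' (deformationMap f' N)).comp (symMap h (deformationTransport f' h rfl N)) =
      symMap (f'.comp h) (deformationMap (f'.comp h) N) := by
    refine symHom_ext (fun c => ?_) (fun x => ?_)
    · simp [symMap_algebraMap]
    · simp only [RingHom.comp_apply, symMap_ι]; rfl
  exact RingHom.congr_fun h1 z

theorem reesMap_deformationTransport {f : R →+* A} (f' : R' →+* A) (h : R →+* R')
    (hh : f'.comp h = f) (N : Submodule A (Fin n → A)) (z : SymmetricAlgebra R (deformation f N)) :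
    reesMap (deformation f' N) (symMap h (deformationTransport f' h hh N) z) =
      map h (reesMap (deformation f N) z) := by
  have h1 : (reesMap (deformation f' N)).toRingHom.comp
      (symMap h (deformationTransport f' h hh N)) =
      (map h).comp (reesMap (deformation f N)).toRingHom := by
    refine symHom_ext (fun c => ?_) (fun x => ?_)
    · simp [symMap_algebraMap, MvPolynomial.algebraMap_eq]
    · simp only [RingHom.comp_apply, symMap_ι, AlgHom.toRingHom_eq_coe, RingHom.coe_coe, reesMap_ι,
        linForm_apply, map_sum, map_mul, map_C, map_X]
      rfl
  exact RingHom.congr_fun h1 z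

end ReesMap

/-! ### Independence of the embedded Aluffi algebra from the smooth ambient ring -/

section ArtinRees

open MvPolynomial

/-- A finitely generated `F` lies in a finite free module `G` of polynomials with bounded support,
where the coefficient condition says `v ∈ K^t G`. Artin–Rees for `F ⊆ G` then applies, with `t` one
more than its constant. -/
theorem exists_pow_coeff_mem_imp_mem_smul {P σ : Type*} [CommRing P] [IsNoetherianRing P]
    (K : Ideal P) (F : Submodule P (MvPolynomial σ P)) (hF : F.FG) :
    ∃ t : ℕ, 0 < t ∧ ∀ v ∈ F, (∀ a, coeff a v ∈ K ^ t) → v ∈ K • F := by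
  classical
  obtain ⟨S, rfl⟩ := hF
  set F := Submodule.span P (S : Set (MvPolynomial σ P))
  let s : Finset (σ →₀ ℕ) := S.biUnion fun g => g.support
  let G := restrictSupport P (s : Set (σ →₀ ℕ))
  have hFG : F ≤ G := by
    refine Submodule.span_le.2 fun g hg => ?_
    rw [SetLike.mem_coe, mem_restrictSupport_iff]
    exact_mod_cast Finset.subset_biUnion_of_mem (fun g : MvPolynomial σ P => g.support) hg
  have : Module.Finite P G := .of_basis (basisRestrictSupport P (s : Set (σ →₀ ℕ)))
  obtain ⟨c, hc⟩ := Ideal.exists_pow_inf_eq_pow_smul K (F.comap G.subtype)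
  refine ⟨c + 1, Nat.succ_pos c, fun v hv hcoeff => ?_⟩
  have hvG : (⟨v, hFG hv⟩ : G) ∈ K ^ (c + 1) • (⊤ : Submodule P G) := by
    have hsum : (⟨v, hFG hv⟩ : G) = ∑ a : v.support, coeff a v • (⟨monomial a 1, by
        rw [monomial_mem_restrictSupport]
        exact Or.inl ((mem_restrictSupport_iff P).1 (hFG hv) a.2)⟩ : G) := by
      apply Subtype.ext
      rw [Submodule.coe_sum]
      refine v.as_sum.trans ?_
      rw [← Finset.sum_coe_sort]
      simp [smul_monomial]
    rw [hsum]
    exact Submodule.sum_mem _ fun a _ => Submodule.smul_mem_smul (hcoeff a) trivial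
  have h1 : (⟨v, hFG hv⟩ : G) ∈ K ^ (c + 1) • (⊤ : Submodule P G) ⊓ F.comap G.subtype := ⟨hvG, hv⟩
  rw [hc (c + 1) (Nat.le_succ c), Nat.add_sub_cancel_left, pow_one] at h1
  have h2 : (⟨v, hFG hv⟩ : G) ∈ K • F.comap G.subtype := Submodule.smul_mono le_rfl inf_le_right h1
  have h3 := Submodule.mem_map_of_mem (f := G.subtype) h2
  rw [Submodule.map_smul''] at h3
  exact Submodule.smul_mono le_rfl (Submodule.map_comap_le _ _) h3

/-- The elements of degree at most `i` in a symmetric algebra. -/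
noncomputable def symFiltration (R M : Type*) [CommRing R] [AddCommGroup M] [Module R M] (i : ℕ) :
    Submodule R (SymmetricAlgebra R M) :=
  (1 ⊔ LinearMap.range (SymmetricAlgebra.ι R M)) ^ i

section

variable (R M : Type*) [CommRing R] [AddCommGroup M] [Module R M]

theorem symFiltration_fg [Module.Finite R M] (i : ℕ) : (symFiltration R M i).FG := by
  refine Submodule.FG.pow (Submodule.FG.sup ?_ ?_) i
  · exact Submodule.one_eq_span (R := R) (A := SymmetricAlgebra R M) ▸ Submodule.fg_span_singleton 1
  · rw [LinearMap.range_eq_map]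
    exact Module.Finite.fg_top.map _

theorem symFiltration_mono : Monotone (symFiltration R M) := fun _ _ h =>
  pow_le_pow_right' le_sup_left h

variable {R M}

theorem algebraMap_mem_symFiltration (c : R) (i : ℕ) : algebraMap R _ c ∈ symFiltration R M i :=
  symFiltration_mono R M (Nat.zero_le i) (by
    rw [symFiltration, pow_zero]
    exact Submodule.algebraMap_mem c)

theorem ι_mem_symFiltration (x : M) : SymmetricAlgebra.ι R M x ∈ symFiltration R M 1 := by
  rw [symFiltration, pow_one]
  exact Submodule.mem_sup_right ⟨x, rfl⟩

theorem mul_mem_symFiltration {i j : ℕ} {a b : SymmetricAlgebra R M} (ha : a ∈ symFiltration R M i)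
    (hb : b ∈ symFiltration R M j) : a * b ∈ symFiltration R M (i + j) := by
  rw [symFiltration, pow_add]
  exact Submodule.mul_mem_mul ha hb

end

/-- The embedded Aluffi ideal does not change when a formally smooth ambient ring is replaced
by a Noetherian ring mapping onto it. -/
theorem aluffiIdeal_eq_of_formallySmooth {k P R A : Type*} [CommRing k] [CommRing P] [Algebra k P]
    [IsNoetherianRing P] [CommRing R] [Algebra k R] [Algebra.FormallySmooth k R] [CommRing A]
    (h : P →ₐ[k] R) (hsurj : Function.Surjective h) (f : R →+* A) {n : ℕ}
    (N : Submodule A (Fin n → A)) :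
    aluffiIdeal (f.comp h.toRingHom) N = aluffiIdeal f N := by
  set f₀ := f.comp h.toRingHom with hf₀
  refine le_antisymm (aluffiIdeal_le f₀ f h.toRingHom rfl N) ?_
  let K : Ideal P := RingHom.ker h
  have hK : ∀ c ∈ K, f₀ c = 0 := fun c hc => by
    rw [hf₀, RingHom.comp_apply, show h.toRingHom c = 0 from hc, map_zero]
  refine Ideal.map_le_iff_le_comap.2 fun z hz => ?_
  rw [Ideal.mem_comap]
  -- The degree bound `i` has to be uniform in `P'`: it will be used with `P' = P/K^t`, where `t` is
  -- chosen after `i`.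
  have hstep : ∃ i, ∀ (P' : Type _) [CommRing P'] (q : P →+* P') (hq : Function.Surjective q)
      (f' : P' →+* A) (hf' : f'.comp q = f₀) (σ : R →+* P') (hσ : f'.comp σ = f),
      ∃ w ∈ symFiltration P (deformation f₀ N) i,
        symMap q (deformationTransport f' q hf' N) w =
          symMap σ (deformationTransport f' σ hσ N) z := by
    clear hz
    induction z using SymmetricAlgebra.induction with
    | algebraMap c =>
      refine ⟨0, fun P' _ q hq f' hf' σ hσ => ?_⟩
      obtain ⟨p, hp⟩ := hq (σ c)
      exact ⟨algebraMap P _ p, algebraMap_mem_symFiltration p 0, by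
        rw [symMap_algebraMap, symMap_algebraMap, hp]⟩
    | ι x =>
      refine ⟨1, fun P' _ q hq f' hf' σ hσ => ?_⟩
      choose y hy using fun i => hq (σ (x.1 i))
      -- Membership in a deformation depends only on the image in `A^n`, so any coordinatewise lift
      -- lies in it.
      have hyN : y ∈ deformation f₀ N := by
        change coordMap f₀ n y ∈ N
        have : coordMap f₀ n y = coordMap f n x := by
          ext i
          change f₀ (y i) = f (x.1 i)
          rw [← hf', RingHom.comp_apply, hy]
          exact RingHom.congr_fun hσ _
        rw [this]
        exact x.2
      refine ⟨SymmetricAlgebra.ι P _ ⟨y, hyN⟩, ι_mem_symFiltration _, ?_⟩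
      rw [symMap_ι, symMap_ι]
      congr 1
      ext i
      exact hy i
    | mul a b ha hb =>
      obtain ⟨i, hi⟩ := ha
      obtain ⟨j, hj⟩ := hb
      refine ⟨i + j, fun P' _ q hq f' hf' σ hσ => ?_⟩
      obtain ⟨v, hv, hv'⟩ := hi P' q hq f' hf' σ hσ
      obtain ⟨w, hw, hw'⟩ := hj P' q hq f' hf' σ hσ
      exact ⟨v * w, mul_mem_symFiltration hv hw, by rw [map_mul, map_mul, hv', hw']⟩
    | add a b ha hb =>
      obtain ⟨i, hi⟩ := ha
      obtain ⟨j, hj⟩ := hb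
      refine ⟨i + j, fun P' _ q hq f' hf' σ hσ => ?_⟩
      obtain ⟨v, hv, hv'⟩ := hi P' q hq f' hf' σ hσ
      obtain ⟨w, hw, hw'⟩ := hj P' q hq f' hf' σ hσ
      exact ⟨v + w, add_mem (symFiltration_mono P _ (Nat.le_add_right i j) hv)
        (symFiltration_mono P _ (Nat.le_add_left j i) hw), by rw [map_add, map_add, hv', hw']⟩
  obtain ⟨i, hi⟩ := hstep
  have hfin : Module.Finite P (deformation f₀ N) := inferInstance
  set M := deformation f₀ N with hM
  obtain ⟨t, ht, hAR⟩ := exists_pow_coeff_mem_imp_mem_smul K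
    ((symFiltration P M i).map (reesMap M).toLinearMap) ((symFiltration_fg P M i).map _)
  let q : P →ₐ[k] P ⧸ K ^ t := Ideal.Quotient.mkₐ k (K ^ t)
  let g : P ⧸ K ^ t →ₐ[k] R := Ideal.Quotient.liftₐ (K ^ t) h fun a ha => Ideal.pow_le_self ht.ne' ha
  have hg : Function.Surjective g := fun y => by
    obtain ⟨x, rfl⟩ := hsurj y
    exact ⟨q x, rfl⟩
  -- The kernel of `P/K^t → R` is `K/K^t`, so formal smoothness yields a section `σ`.
  have hnil : IsNilpotent (RingHom.ker (g : P ⧸ K ^ t →+* R)) := by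
    refine ⟨t, ?_⟩
    have hker : RingHom.ker (g : P ⧸ K ^ t →+* R) ≤ K.map (Ideal.Quotient.mk (K ^ t)) := by
      intro y hy
      obtain ⟨x, rfl⟩ := Ideal.Quotient.mk_surjective y
      exact Ideal.mem_map_of_mem _ hy
    rw [Ideal.zero_eq_bot, eq_bot_iff]
    refine (Ideal.pow_right_mono hker t).trans ?_
    rw [← Ideal.map_pow, Ideal.map_quotient_self]
  let σ := Algebra.FormallySmooth.liftOfSurjective (AlgHom.id k R) g hg hnil
  have hσ : (f.comp g.toRingHom).comp σ.toRingHom = f := by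
    ext x
    exact congrArg f (Algebra.FormallySmooth.liftOfSurjective_apply (AlgHom.id k R) g hg hnil x)
  have hq : (f.comp g.toRingHom).comp q.toRingHom = f₀ := rfl
  obtain ⟨w, hw, hwz⟩ := hi (P ⧸ K ^ t) q.toRingHom Ideal.Quotient.mk_surjective
    (f.comp g.toRingHom) hq σ.toRingHom hσ
  -- Modulo `K^t`, the Rees image of `w` is `σ` applied to that of `z`, which is zero; so all its
  -- coefficients lie in `K^t`.
  have hv : reesMap M w ∈ K • (symFiltration P M i).map (reesMap M).toLinearMap := by
    refine hAR _ ⟨w, hw, rfl⟩ fun a => ?_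
    have h1 := congrArg (reesMap (deformation (f.comp g.toRingHom) N)) hwz
    have h2 := congrArg (coeff a) ((reesMap_deformationTransport (f.comp g.toRingHom) q.toRingHom
      hq N w).symm.trans (h1.trans (reesMap_deformationTransport _ σ.toRingHom hσ N z)))
    rw [(mem_reesIdeal_iff_reesMap _ z).1 hz, map_zero] at h2
    rw [coeff_map, coeff_zero] at h2
    exact Ideal.Quotient.eq_zero_iff_mem.1 h2
  rw [← Submodule.map_smul''] at hv
  obtain ⟨w', hw', hw''⟩ := hv
  -- `w'` has the same Rees image as `w` but has coefficients in `K`, which dies in `A`. So the Rees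
  -- relation `w - w'` has the same image in `S_A(N)` as `w`, hence as `z`.
  have hw'0 : symMap f₀ (deformationMap f₀ N) w' = 0 := by
    refine Submodule.smul_induction_on hw' (fun c hc x _ => ?_) fun x y hx hy => ?_
    · rw [Algebra.smul_def, map_mul, symMap_algebraMap, hK c hc, map_zero, zero_mul]
    · rw [map_add, hx, hy, add_zero]
  have hmem : w - w' ∈ reesIdeal M := by
    rw [mem_reesIdeal_iff_reesMap, map_sub, sub_eq_zero]
    exact hw''.symm
  have h3 := Ideal.mem_map_of_mem (symMap f₀ (deformationMap f₀ N)) hmem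
  rw [map_sub, hw'0, sub_zero] at h3
  have h4 := congrArg (symMap (f.comp g.toRingHom) (deformationMap (f.comp g.toRingHom) N)) hwz
  rw [symMap_deformationTransport, symMap_deformationTransport] at h4
  rw [← h4]
  exact h3

end ArtinRees

end ModuleAluffi

namespace ModuleAluffi

/-! ### The absolute Aluffi algebra as an embedded one -/

section Limit

open MvPolynomial

universe u v

variable {k : Type u} [Field k] {A : Type v} [CommRing A] [Algebra k A]

/-- A polynomial ring mapping onto `A` as an ambient ring. -/
noncomputable def polyAmbient {ι : Type} [Finite ι] (x : ι → A)
    (hx : Function.Surjective (aeval (R := k) x)) : Ambient k A where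
  carrier := MvPolynomial ι k
  hom := aeval x
  surjective := hx

/-- The lift need not be surjective. That is enough to compare Aluffi ideals, though not to give a
transition map of the limit. -/
theorem exists_algHom_of_polyAmbient {ι : Type} [Finite ι] (x : ι → A) (i : Ambient k A) :
    ∃ h : MvPolynomial ι k →ₐ[k] i.carrier, i.hom.comp h = aeval x := by
  choose y hy using fun j => i.surjective (x j)
  refine ⟨aeval y, ?_⟩
  ext j
  simp [hy]

/-- Take the variables of the given polynomial ring together with generators of the other ambient
ring. Each projection is surjective already on its own block of variables. -/
theorem exists_polyAmbient_dominating {ι : Type} [Finite ι] (x : ι → A)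
    (hx : Function.Surjective (aeval (R := k) x)) (i : Ambient k A) :
    ∃ (κ : Type) (_ : Finite κ) (y : κ → A) (_ : Function.Surjective (aeval (R := k) y))
      (a : MvPolynomial κ k →ₐ[k] MvPolynomial ι k) (b : MvPolynomial κ k →ₐ[k] i.carrier),
      Function.Surjective a ∧ Function.Surjective b ∧ (aeval x).comp a = aeval y ∧
        i.hom.comp b = aeval y := by
  obtain ⟨t, q, hq⟩ := (Algebra.FiniteType.iff_quotient_mvPolynomial'' (R := k)
    (S := i.carrier)).1 inferInstance
  let y : ι ⊕ Fin t → A := Sum.elim x fun j => i.hom (q (X j))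
  choose u hu using fun j => i.surjective (x j)
  choose w hw using fun j => hx (i.hom (q (X j)))
  let a : MvPolynomial (ι ⊕ Fin t) k →ₐ[k] MvPolynomial ι k := aeval (Sum.elim X w)
  let b : MvPolynomial (ι ⊕ Fin t) k →ₐ[k] i.carrier := aeval (Sum.elim u fun j => q (X j))
  have ha : Function.Surjective a := by
    have : a.comp (rename Sum.inl) = AlgHom.id k _ := by ext j; simp [a]
    exact fun z => ⟨rename Sum.inl z, AlgHom.congr_fun this z⟩
  have hb : Function.Surjective b := by
    have : b.comp (rename Sum.inr) = q := by ext j; simp [b]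
    intro z
    obtain ⟨z, rfl⟩ := hq z
    exact ⟨rename Sum.inr z, AlgHom.congr_fun this z⟩
  have h1 : (aeval x).comp a = aeval (R := k) y := by
    ext j
    rcases j with j | j <;> simp [a, y, hw]
  have h2 : i.hom.comp b = aeval (R := k) y := by
    ext j
    rcases j with j | j <;> simp [b, y, hu]
  refine ⟨ι ⊕ Fin t, inferInstance, y, ?_, a, b, ha, hb, h1, h2⟩
  rw [← h1]
  exact hx.comp ha

/-- Evaluation at the polynomial ring is bijective. A family vanishing there vanishes at every
dominating polynomial ring, by minimality of the ideal, hence everywhere; a constant family gives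
surjectivity. -/
theorem aluffiAlgebra_equiv_of_polynomial {ι : Type} [Finite ι] (x : ι → A)
    (hx : Function.Surjective (aeval (R := k) x)) {n : ℕ} (N : Submodule A (Fin n → A)) :
    Nonempty (aluffiAlgebra k N ≃+* EmbeddedAluffi (aeval (R := k) x).toRingHom N) := by
  let i₀ := polyAmbient x hx
  have hle : ∀ i : Ambient k A, aluffiIdeal i₀.hom.toRingHom N ≤ aluffiIdeal i.hom.toRingHom N := by
    intro i
    obtain ⟨h, hh⟩ := exists_algHom_of_polyAmbient x i
    exact aluffiIdeal_le _ _ h.toRingHom (congrArg AlgHom.toRingHom hh) N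
  let ev : aluffiAlgebra k N →+* EmbeddedAluffi i₀.hom.toRingHom N :=
    (Pi.evalRingHom _ i₀).comp (aluffiAlgebra k N).subtype
  suffices h : Function.Bijective ev from ⟨RingEquiv.ofBijective ev h⟩
  refine ⟨?_, fun b => ?_⟩
  · rw [injective_iff_map_eq_zero]
    intro z hz
    apply Subtype.ext
    funext i
    obtain ⟨κ, _, y, hy, a, b, ha, hb, h1, h2⟩ := exists_polyAmbient_dominating x hx i
    let j := polyAmbient y hy
    have e1 := z.2 j i₀ a ha (congrArg AlgHom.toRingHom h1)
    have e2 := z.2 j i b hb (congrArg AlgHom.toRingHom h2)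
    have hz' : z.1 i₀ = 0 := hz
    obtain ⟨c, hc⟩ := Ideal.Quotient.mk_surjective (z.1 j)
    rw [hz', ← hc, Ideal.Quotient.factor_mk, Ideal.Quotient.eq_zero_iff_mem] at e1
    have hc0 : z.1 j = 0 := by
      rw [← hc, Ideal.Quotient.eq_zero_iff_mem]
      exact hle j e1
    rw [← e2, hc0, map_zero]
    rfl
  · obtain ⟨c, rfl⟩ := Ideal.Quotient.mk_surjective b
    exact ⟨⟨fun i => Ideal.Quotient.mk _ c, fun i j h hs hh => Ideal.Quotient.factor_mk _ _⟩, rfl⟩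

/-- The absolute Aluffi algebra is the embedded Aluffi algebra of any smooth ambient ring. -/
theorem aluffiAlgebra_equiv_of_smooth {R : Type*} [CommRing R] [Algebra k R]
    [Algebra.FiniteType k R] [Algebra.FormallySmooth k R] (π : R →ₐ[k] A)
    (hπ : Function.Surjective π) {n : ℕ} (N : Submodule A (Fin n → A)) :
    Nonempty (aluffiAlgebra k N ≃+* EmbeddedAluffi π.toRingHom N) := by
  obtain ⟨s, h, hh⟩ := (Algebra.FiniteType.iff_quotient_mvPolynomial'' (R := k) (S := R)).1
    inferInstance
  have hx : π.comp h = aeval fun j => π (h (X j)) := by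
    ext j
    simp
  have hsurj : Function.Surjective (π.comp h) := hπ.comp hh
  rw [hx] at hsurj
  obtain ⟨e⟩ := aluffiAlgebra_equiv_of_polynomial (fun j => π (h (X j))) hsurj N
  have h1 : aluffiIdeal (aeval (R := k) fun j => π (h (X j))).toRingHom N =
      aluffiIdeal π.toRingHom N := by
    rw [← hx]
    exact aluffiIdeal_eq_of_formallySmooth h hh π.toRingHom N
  exact ⟨e.trans (Ideal.quotEquivOfEq h1)⟩

end Limit

end ModuleAluffi

namespace ModuleAluffi

/-! ### The upper bound by the dimension of the ambient polynomial ring -/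

section AmbientBound

open MvPolynomial

theorem symmetricAlgebra_finiteType (R M : Type*) [CommRing R] [AddCommGroup M] [Module R M]
    [Module.Finite R M] : Algebra.FiniteType R (SymmetricAlgebra R M) := by
  classical
  obtain ⟨s, hs⟩ := (Module.Finite.fg_top : (⊤ : Submodule R M).FG)
  refine ⟨⟨s.image (SymmetricAlgebra.ι R M), eq_top_iff.2 fun z _ => ?_⟩⟩
  induction z using SymmetricAlgebra.induction with
  | algebraMap c => exact Subalgebra.algebraMap_mem _ c
  | ι x =>
    have hx : x ∈ Submodule.span R (s : Set M) := hs ▸ trivial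
    induction hx using Submodule.span_induction with
    | mem x hx => exact Algebra.subset_adjoin (by simpa using ⟨x, hx, rfl⟩)
    | zero => simp
    | add x y _ _ hx hy => rw [map_add]; exact add_mem (hx trivial) (hy trivial)
    | smul c x _ hx => rw [map_smul]; exact Subalgebra.smul_mem _ (hx trivial) c
  | mul a b ha hb => exact mul_mem (ha trivial) (hb trivial)
  | add a b ha hb => exact add_mem (ha trivial) (hb trivial)

theorem symMap_surjective {R S M N : Type*} [CommRing R] [CommRing S] [AddCommGroup M] [Module R M]
    [AddCommGroup N] [Module S N] {f : R →+* S} {g : M →ₛₗ[f] N} (hf : Function.Surjective f)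
    (hg : Function.Surjective g) : Function.Surjective (symMap f g) := by
  intro z
  induction z using SymmetricAlgebra.induction with
  | algebraMap c =>
    obtain ⟨c, rfl⟩ := hf c
    exact ⟨_, symMap_algebraMap f g c⟩
  | ι x =>
    obtain ⟨x, rfl⟩ := hg x
    exact ⟨_, symMap_ι f g x⟩
  | mul a b ha hb =>
    obtain ⟨a, rfl⟩ := ha
    obtain ⟨b, rfl⟩ := hb
    exact ⟨a * b, map_mul _ _ _⟩
  | add a b ha hb =>
    obtain ⟨a, rfl⟩ := ha
    obtain ⟨b, rfl⟩ := hb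
    exact ⟨a + b, map_add _ _ _⟩

theorem deformationMap_surjective {R A : Type*} [CommRing R] [CommRing A] {f : R →+* A}
    (hf : Function.Surjective f) {n : ℕ} (N : Submodule A (Fin n → A)) :
    Function.Surjective (deformationMap f N) := by
  rintro ⟨y, hy⟩
  choose x hx using fun i => hf (y i)
  have hxy : coordMap f n x = y := funext hx
  exact ⟨⟨x, show coordMap f n x ∈ N by rwa [hxy]⟩, Subtype.ext hxy⟩

theorem tdim_mvPolynomial_quotient_le {k R : Type*} [Field k] [CommRing R] [Algebra k R]
    [Algebra.FiniteType k R] {n : ℕ} (Q : Ideal (MvPolynomial (Fin n) R)) [Q.IsPrime] :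
    tdim k (MvPolynomial (Fin n) R ⧸ Q) ≤ tdim k (R ⧸ Q.comap C) + n := by
  set p := Q.comap (C : R →+* MvPolynomial (Fin n) R) with hp
  let φ₀ : R ⧸ p →+* MvPolynomial (Fin n) R ⧸ Q := Ideal.quotientMap Q C le_rfl
  let φ : MvPolynomial (Fin n) (R ⧸ p) →+* MvPolynomial (Fin n) R ⧸ Q :=
    eval₂Hom φ₀ fun i => Ideal.Quotient.mk Q (X i)
  let φk : MvPolynomial (Fin n) (R ⧸ p) →ₐ[k] MvPolynomial (Fin n) R ⧸ Q :=
    { φ with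
      commutes' := fun c => by
        have h1 : algebraMap k (MvPolynomial (Fin n) (R ⧸ p)) c =
          C (Ideal.Quotient.mk p (algebraMap k R c)) := rfl
        have h2 : φ (C (Ideal.Quotient.mk p (algebraMap k R c))) =
            Ideal.Quotient.mk Q (C (algebraMap k R c)) := by
          rw [coe_eval₂Hom, eval₂_C]
          exact Ideal.quotientMap_mk
        exact (congrArg φ h1).trans h2 }
  have hφ : Function.Surjective φk := by
    intro y
    obtain ⟨y, rfl⟩ := Ideal.Quotient.mk_surjective y
    refine ⟨map (Ideal.Quotient.mk p) y, ?_⟩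
    have : φ.comp (map (Ideal.Quotient.mk p)) = Ideal.Quotient.mk Q := by
      ext
      · simp [φ, φ₀]
      · simp [φ]
    exact RingHom.congr_fun this y
  refine (tdim_le_of_surjective φk hφ).trans ?_
  rw [tdim_add_eq k (R ⧸ p) (MvPolynomial (Fin n) (R ⧸ p)) (algebraMap k _).injective
    (C_injective _ _), tdim_mvPolynomial, Nat.card_fin]

/-- A minimal prime of `ker ψ` is contracted from a prime of `R[X]`, because `S/ker ψ` embeds there.
So `S/Q` is a quotient of a domain embedded in a quotient of `R[X]`, whose transcendence degree
exceeds that of its base by at most `n`. -/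
theorem ringKrullDim_quotient_le_of_ker_le {k R S : Type*} [Field k] [CommRing R] [Algebra k R]
    [Algebra.FiniteType k R] [CommRing S] [Algebra k S] [Algebra R S] [IsScalarTower k R S]
    [Algebra.FiniteType R S] {n : ℕ} (ψ : S →ₐ[R] MvPolynomial (Fin n) R) (Q : Ideal S)
    [Q.IsPrime] (hQ : RingHom.ker ψ ≤ Q) (c : ℕ)
    (hc : ∀ P₀ : Ideal R, P₀.IsPrime → P₀ ≤ Q.comap (algebraMap R S) → tdim k (R ⧸ P₀) ≤ c) :
    ringKrullDim (S ⧸ Q) ≤ (c + n : ℕ) := by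
  have : Algebra.FiniteType k S := .trans (S := R) inferInstance inferInstance
  obtain ⟨Q₀, hQ₀, hle⟩ := Ideal.exists_minimalPrimes_le hQ
  have hQ₀p : Q₀.IsPrime := hQ₀.1.1
  obtain ⟨Q₁, hQ₁p, -, hQ₁⟩ := Ideal.exists_comap_eq_of_mem_minimalPrimes (I := ⊥) ψ.toRingHom Q₀ hQ₀
  have h1 : ringKrullDim (S ⧸ Q) ≤ ringKrullDim (S ⧸ Q₀) :=
    ringKrullDim_le_of_surjective (Ideal.Quotient.factor hle) (Ideal.Quotient.factor_surjective hle)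
  refine h1.trans ?_
  rw [ringKrullDim_eq_tdim k]
  have h2 : tdim k (S ⧸ Q₀) ≤ tdim k (MvPolynomial (Fin n) R ⧸ Q₁) := by
    subst hQ₁
    exact tdim_le_of_injective k (Ideal.quotientMapₐ Q₁ (ψ.restrictScalars k) le_rfl)
      (Ideal.quotientMap_injective (f := ψ.toRingHom) (I := Q₁))
  have h3 : Q₁.comap C ≤ Q.comap (algebraMap R S) := by
    intro x hx
    refine hle ?_
    rw [← hQ₁]
    change ψ (algebraMap R S x) ∈ Q₁
    rw [ψ.commutes]
    exact hx
  have h4 := (h2.trans (tdim_mvPolynomial_quotient_le Q₁)).trans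
    (Nat.add_le_add_right (hc _ inferInstance h3) n)
  exact_mod_cast h4

theorem ringKrullDim_embeddedAluffi_le {k R A : Type*} [Field k] [CommRing R] [Algebra k R]
    [Algebra.FiniteType k R] [Algebra.Smooth k R] [CommRing A] [Algebra k A] (π : R →ₐ[k] A)
    (hπ : Function.Surjective π) (hequi : IsEquidimensional A) (d g : ℕ) (hd : ringKrullDim A = d)
    (hg : (RingHom.ker π).height = g)
    (hJ : ∀ P ∈ (RingHom.ker π).minimalPrimes, P.height = (RingHom.ker π).height) {n : ℕ}
    (N : Submodule A (Fin n → A)) :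
    ringKrullDim (EmbeddedAluffi π.toRingHom N) ≤ (d + n + g : ℕ) := by
  refine ringKrullDim_le_of_forall_quotient_le _ fun Q hQ => ?_
  set M := deformation π.toRingHom N
  let S := SymmetricAlgebra R M
  have : IsNoetherianRing R := Algebra.FiniteType.isNoetherianRing k R
  have : Algebra.FiniteType R S := symmetricAlgebra_finiteType R M
  let _ : Algebra k S := Algebra.compHom S (algebraMap k R)
  have : @IsScalarTower k R S Algebra.toSMul Algebra.toSMul Algebra.toSMul :=
    .of_algebraMap_eq fun _ => rfl
  let Φ : S →+* EmbeddedAluffi π.toRingHom N :=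
    (Ideal.Quotient.mk _).comp (symMap π.toRingHom (deformationMap π.toRingHom N))
  have hΦ : Function.Surjective Φ :=
    Ideal.Quotient.mk_surjective.comp (symMap_surjective hπ (deformationMap_surjective hπ N))
  have h1 : ringKrullDim (EmbeddedAluffi π.toRingHom N ⧸ Q) ≤ ringKrullDim (S ⧸ Q.comap Φ) := by
    refine ringKrullDim_le_of_surjective (Ideal.quotientMap Q Φ le_rfl) ?_
    exact Ideal.quotientMap_surjective hΦ
  -- The embedded Aluffi algebra is a quotient of the Rees algebra of `M`.
  have hker : RingHom.ker (reesMap M) ≤ Q.comap Φ := by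
    intro z hz
    have : Φ z = 0 := Ideal.Quotient.eq_zero_iff_mem.2
      (Ideal.mem_map_of_mem _ ((mem_reesIdeal_iff_reesMap M z).2 hz))
    rw [Ideal.mem_comap, this]
    exact zero_mem Q
  set P := (Q.comap Φ).comap (algebraMap R S)
  have hPJ : RingHom.ker π ≤ P := by
    intro x hx
    have : Φ (algebraMap R S x) = 0 := by
      change Ideal.Quotient.mk _ (symMap _ _ (algebraMap R S x)) = 0
      rw [symMap_algebraMap, show π.toRingHom x = 0 from hx, map_zero, map_zero]
    change Φ (algebraMap R S x) ∈ Q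
    rw [this]
    exact zero_mem Q
  obtain ⟨P', hP', hP'P⟩ := Ideal.exists_minimalPrimes_le hPJ
  have hP'p : P'.IsPrime := hP'.1.1
  obtain ⟨e, he⟩ := exists_smooth_dimension k R P
  -- Minimal primes of `J` correspond to those of `A`, so equidimensionality applies.
  have hdim : tdim k (R ⧸ P') = d := by
    have hmin : P' ∈ (Ideal.comap π.toRingHom ⊥).minimalPrimes := hP'
    rw [Ideal.comap_minimalPrimes_eq_of_surjective hπ] at hmin
    obtain ⟨p, hp, rfl⟩ := hmin
    have e : R ⧸ p.comap π.toRingHom ≃+* A ⧸ p :=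
      .ofBijective (Ideal.quotientMap p π.toRingHom le_rfl)
        ⟨Ideal.quotientMap_injective, Ideal.quotientMap_surjective hπ⟩
    have h2 := ringKrullDim_eq_of_ringEquiv e
    rw [hequi p hp, hd, ringKrullDim_eq_tdim k] at h2
    exact_mod_cast h2
  have hed : e ≤ d + g := by
    have := (he P' hP'p hP'P).2
    rw [hJ P' hP', hg, hdim] at this
    rw [add_comm]
    exact_mod_cast this
  have h3 := ringKrullDim_quotient_le_of_ker_le (k := k) (S := S) (reesMap M) (Q.comap Φ) hker e
    fun P₀ hP₀ hle => (he P₀ hP₀ hle).1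
  refine h1.trans (h3.trans ?_)
  have : e + n ≤ d + n + g := by omega
  exact_mod_cast this

end AmbientBound

end ModuleAluffi

namespace ModuleAluffi

/-! ### Modules with a rank, and the rank of a presentation matrix -/

section Rank

/-- This is a basis of the localization with denominators cleared, stated with elements of `A` and
`E` only. -/
theorem HasRank.exists_generators {A E : Type*} [CommRing A] [AddCommGroup E] [Module A E] {r : ℕ}
    (hr : HasRank A E r) (p : Ideal A) [p.IsPrime] (hp : p ∈ associatedPrimes A A) :
    ∃ e : Fin r → E, (∀ b : Fin r → A, ∑ i, b i • e i = 0 → ∀ i, ∃ s ∉ p, s * b i = 0) ∧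
      ∀ y : E, ∃ s ∉ p, ∃ c : Fin r → A, s • y = ∑ i, c i • e i := by
  classical
  obtain ⟨ε⟩ := hr p hp
  let Ap := Localization.AtPrime p
  let g : E →ₗ[A] (Fin r → Ap) :=
    (ε.restrictScalars A).toLinearMap ∘ₗ LocalizedModule.mkLinearMap p.primeCompl E
  have hg : IsLocalizedModule p.primeCompl g := IsLocalizedModule.of_linearEquiv _ _ _
  choose x hx using fun i : Fin r => IsLocalizedModule.surj p.primeCompl g (Pi.single i (1 : Ap))
  have hge : ∀ i l, g (x i).1 l = algebraMap A Ap (if l = i then (x i).2 else 0) := fun i l => by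
    rw [← hx i, Pi.smul_apply, Pi.single_apply, Submonoid.smul_def, Algebra.smul_def]
    split_ifs <;> simp
  have hsum : ∀ (b : Fin r → A) l, g (∑ i, b i • (x i).1) l = algebraMap A Ap (b l * (x l).2) := by
    intro b l
    rw [map_sum, Finset.sum_apply, Finset.sum_eq_single l]
    · rw [map_smul, Pi.smul_apply, hge, if_pos rfl, Algebra.smul_def, map_mul]
    · intro i _ hi
      rw [map_smul, Pi.smul_apply, hge, if_neg hi.symm, map_zero, smul_zero]
    · simp
  refine ⟨fun i => (x i).1, fun b hb i => ?_, fun y => ?_⟩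
  · have h1 := hsum b i
    rw [hb, map_zero, Pi.zero_apply, eq_comm, IsLocalization.map_eq_zero_iff p.primeCompl] at h1
    obtain ⟨s, hs⟩ := h1
    refine ⟨s * (x i).2, mul_mem s.2 (x i).2.2, ?_⟩
    rw [mul_assoc, mul_comm _ (b i), hs]
  · obtain ⟨t, ht⟩ := IsLocalization.exist_integer_multiples_of_finite p.primeCompl (g y)
    choose a ha using ht
    have heq : g (((∏ i, ((x i).2 : A)) * t) • y) =
        g (∑ i, ((∏ j ∈ Finset.univ.erase i, ((x j).2 : A)) * a i) • (x i).1) := by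
      ext l
      rw [hsum, map_smul, Pi.smul_apply, mul_smul, ← ha, ← algebraMap_smul Ap,
        smul_eq_mul, ← map_mul]
      congr 1
      rw [← Finset.mul_prod_erase Finset.univ _ (Finset.mem_univ l)]
      ring
    obtain ⟨u, hu⟩ := IsLocalizedModule.exists_of_eq (S := p.primeCompl) heq
    refine ⟨u * ((∏ i, ((x i).2 : A)) * t),
      mul_mem u.2 (mul_mem (prod_mem fun i _ => (x i).2.2) t.2),
      fun i => u * ((∏ j ∈ Finset.univ.erase i, ((x j).2 : A)) * a i), ?_⟩
    rw [mul_smul]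
    refine hu.trans ?_
    rw [Submonoid.smul_def, Finset.smul_sum]
    simp only [mul_smul]

theorem exists_orderEmbedding_linearIndependent {K V : Type*} [Field K] [AddCommGroup V]
    [Module K V] {m ρ : ℕ} (v : Fin m → V)
    (hρ : ρ ≤ Module.finrank K (Submodule.span K (Set.range v))) :
    ∃ a : Fin ρ ↪o Fin m, LinearIndependent K (v ∘ a) := by
  classical
  obtain ⟨κ, a, ha, hspan, hli⟩ := exists_linearIndependent' K v
  have : Fintype κ := Fintype.ofInjective a ha
  rw [← hspan, finrank_span_eq_card hli] at hρ
  obtain ⟨s, hs, hcard⟩ := Finset.exists_subset_card_eq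
    (hρ.trans (Finset.card_image_of_injective Finset.univ ha).ge)
  refine ⟨s.orderEmbOfFin hcard, ?_⟩
  have hmem : ∀ i, ∃ j, a j = s.orderEmbOfFin hcard i := fun i => by
    simpa using hs (s.orderEmbOfFin_mem hcard i)
  choose b hb using hmem
  have hbinj : Function.Injective b := fun i j h => by
    apply (s.orderEmbOfFin hcard).injective
    rw [← hb, ← hb, h]
  convert hli.comp b hbinj using 1
  funext i
  exact congrArg v (hb i).symm

theorem exists_minor_ne_zero {K : Type*} [Field K] {m q ρ : ℕ} (Z : Matrix (Fin m) (Fin q) K)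
    (hρ : ρ ≤ Z.rank) :
    ∃ (a : Fin ρ ↪o Fin m) (b : Fin ρ ↪o Fin q), (Z.submatrix a b).det ≠ 0 := by
  rw [Matrix.rank_eq_finrank_span_row] at hρ
  obtain ⟨a, ha⟩ := exists_orderEmbedding_linearIndependent Z.row hρ
  let W : Matrix (Fin ρ) (Fin q) K := Z.submatrix a id
  have hW : W.rank = ρ := by
    have : LinearIndependent K W.row := ha
    rw [this.rank_matrix, Fintype.card_fin]
  rw [Matrix.rank_eq_finrank_span_cols] at hW
  obtain ⟨b, hb⟩ := exists_orderEmbedding_linearIndependent W.col hW.ge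
  refine ⟨a, b, ?_⟩
  have hcol : LinearIndependent K (Z.submatrix a b).col := hb
  rw [Matrix.linearIndependent_cols_iff_isUnit, Matrix.isUnit_iff_isUnit_det] at hcol
  exact hcol.ne_zero

/-- Over the residue field of `p` the cokernel of `Z` is spanned by `r` elements. Concretely, `C`
expresses the generators through the `e l` up to a factor outside `p`; its left kernel has dimension
at least `m - r` and lies in the column space of `Z`. -/
theorem le_rank_of_presentation {A E : Type*} [CommRing A] [AddCommGroup E] [Module A E]
    (p : Ideal A) [p.IsPrime] {r m q : ℕ} (e : Fin r → E)
    (he : ∀ y : E, ∃ s ∉ p, ∃ c : Fin r → A, s • y = ∑ i, c i • e i)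
    (Z : Matrix (Fin m) (Fin q) A) (π : (Fin m → A) →ₗ[A] E) (hπ : Function.Surjective π)
    (hZ : LinearMap.range Z.mulVecLin = LinearMap.ker π) :
    m ≤ (Z.map (algebraMap A (FractionRing (A ⧸ p)))).rank + r := by
  classical
  let K := FractionRing (A ⧸ p)
  have hval : ∀ x : A, algebraMap A K x = algebraMap (A ⧸ p) K (Ideal.Quotient.mk p x) :=
    fun x => rfl
  have hK : ∀ x : A, algebraMap A K x = 0 ↔ x ∈ p := fun x => by
    rw [hval, FaithfulSMul.algebraMap_eq_zero_iff, Ideal.Quotient.eq_zero_iff_mem]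
  choose s hs c hc using fun j => he (π (Pi.single j 1))
  let S : A := ∏ j, s j
  have hS : S ∉ p := fun h => by
    obtain ⟨j, -, hj⟩ := (Ideal.IsPrime.prod_mem_iff (p := p)).1 h
    exact hs j hj
  let C : Matrix (Fin m) (Fin r) A := fun j l => (∏ i ∈ Finset.univ.erase j, s i) * c j l
  have hC : ∀ j, S • π (Pi.single j 1) = ∑ l, C j l • e l := fun j => by
    simp only [C, mul_smul, ← Finset.smul_sum, ← hc]
    rw [smul_smul, Finset.prod_erase_mul _ _ (Finset.mem_univ j)]
  choose D hD using fun l => hπ (e l)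
  have hker : LinearMap.ker (C.map (algebraMap A K)).vecMulLinear ≤
      LinearMap.range (Z.map (algebraMap A K)).mulVecLin := by
    intro v hv
    obtain ⟨b, hb⟩ := IsLocalization.exist_integer_multiples_of_finite (nonZeroDivisors (A ⧸ p)) v
    choose w' hw' using hb
    choose w hw using fun i => Ideal.Quotient.mk_surjective (I := p) (w' i)
    have hb0 : algebraMap (A ⧸ p) K b ≠ 0 := by
      simp
    have hwv : ∀ i, algebraMap A K (w i) = algebraMap (A ⧸ p) K b * v i := fun i => by
      rw [hval, hw, hw', Algebra.smul_def]
    have hP : ∀ l, ∑ j, w j * C j l ∈ p := fun l => by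
      rw [← hK, map_sum]
      have h1 := congrFun (LinearMap.mem_ker.1 hv) l
      simp only [Matrix.vecMulLinear_apply, Matrix.vecMul, dotProduct, Matrix.map_apply,
        Pi.zero_apply] at h1
      simp only [map_mul, hwv, mul_assoc, ← Finset.mul_sum, h1, mul_zero]
    -- The correction term has coefficients in `p`, so over the residue field it disappears and `v`
    -- becomes a combination of columns of `Z`.
    have hmem : S • w - ∑ l, (∑ j, w j * C j l) • D l ∈ LinearMap.ker π := by
      rw [LinearMap.mem_ker, map_sub, map_smul, map_sum, sub_eq_zero]
      have hw2 : w = ∑ j, w j • (Pi.single j 1 : Fin m → A) := by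
        ext i
        simp [Finset.sum_apply, Pi.single_apply]
      conv_lhs => rw [hw2]
      simp only [map_sum, map_smul, hD, Finset.smul_sum, smul_comm S, hC, Finset.sum_smul, mul_smul]
      rw [Finset.sum_comm]
    rw [← hZ] at hmem
    obtain ⟨u, hu⟩ := hmem
    have hSK : algebraMap A K S ≠ 0 := fun h => hS ((hK S).1 h)
    refine ⟨fun i => (algebraMap A K S * algebraMap (A ⧸ p) K b)⁻¹ * algebraMap A K (u i), ?_⟩
    ext i
    have h2 := congrArg (algebraMap A K) (congrFun hu i)
    have h3 : algebraMap A K ((∑ l, (∑ j, w j * C j l) • D l) i) = 0 := by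
      rw [hK, Finset.sum_apply]
      exact sum_mem fun l _ => Ideal.mul_mem_right _ _ (hP l)
    rw [Pi.sub_apply, map_sub, h3, sub_zero, Pi.smul_apply, smul_eq_mul, map_mul, hwv] at h2
    simp only [Matrix.mulVecLin_apply, Matrix.mulVec, dotProduct, map_sum, map_mul] at h2
    simp only [Matrix.mulVecLin_apply, Matrix.mulVec, dotProduct, Matrix.map_apply]
    simp only [mul_left_comm _ (_⁻¹), ← Finset.mul_sum]
    rw [h2, ← mul_assoc (algebraMap A K S), inv_mul_cancel_left₀ (mul_ne_zero hSK hb0)]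
  have h1 := LinearMap.finrank_range_add_finrank_ker (C.map (algebraMap A K)).vecMulLinear
  have h2 := Submodule.finrank_mono hker
  have h3 : Module.finrank K (LinearMap.range (C.map (algebraMap A K)).vecMulLinear) ≤ r := by
    simpa using Submodule.finrank_le (LinearMap.range (C.map (algebraMap A K)).vecMulLinear)
  rw [Module.finrank_fin_fun] at h1
  change _ ≤ (Z.map (algebraMap A K)).rank at h2
  change m ≤ (Z.map (algebraMap A K)).rank + r
  omega

theorem le_matrixRank_add {A E : Type*} [CommRing A] [AddCommGroup E] [Module A E]
    {r m q : ℕ} (hr : HasRank A E r) (p : Ideal A) [p.IsPrime] (hp : p ∈ associatedPrimes A A)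
    (Z : Matrix (Fin m) (Fin q) A) (π : (Fin m → A) →ₗ[A] E) (hπ : Function.Surjective π)
    (hZ : LinearMap.range Z.mulVecLin = LinearMap.ker π) : m ≤ matrixRank Z + r := by
  obtain ⟨e, -, he⟩ := hr.exists_generators p hp
  have h1 := le_rank_of_presentation p e he Z π hπ hZ
  refine h1.trans (Nat.add_le_add_right ?_ r)
  obtain ⟨a, b, hab⟩ := exists_minor_ne_zero
    (Z.map (algebraMap A (FractionRing (A ⧸ p)))) le_rfl
  refine Nat.le_findGreatest (le_min ?_ ?_) ?_
  · simpa using Fintype.card_le_of_injective a a.injective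
  · simpa using Fintype.card_le_of_injective b b.injective
  · intro h
    have h2 : (Z.submatrix a b).det ∈ minorsIdeal Z _ := Ideal.subset_span ⟨a, b, rfl⟩
    rw [h, Ideal.mem_bot] at h2
    apply hab
    rw [Matrix.submatrix_map, ← RingHom.mapMatrix_apply, ← RingHom.map_det, h2, map_zero]

end Rank

/-! ### The upper bound by the Fitting defect -/

section FittingBound

/-- By Cramer's rule, the nonzero minor times each `y (a l)` lies in the subalgebra generated by the
other `m - ρ` generators, so `D` is algebraic over that subalgebra. -/
theorem tdim_le_sub_of_minor {D₀ D : Type*} [CommRing D₀] [CommRing D] [IsDomain D]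
    [Algebra D₀ D] (hinj : Function.Injective (algebraMap D₀ D)) {m q ρ : ℕ}
    (y : Fin m → D) (hy : Algebra.adjoin D₀ (Set.range y) = ⊤) (Z : Matrix (Fin m) (Fin q) D₀)
    (hZ : ∀ j, ∑ i, Z i j • y i = 0) (a : Fin ρ ↪o Fin m) (b : Fin ρ ↪o Fin q)
    (hdet : (Z.submatrix a b).det ≠ 0) : tdim D₀ D ≤ m - ρ := by
  classical
  let s : Set D := y '' ((Set.range a)ᶜ : Set (Fin m))
  let C := Algebra.adjoin D₀ s
  have hs : s.Finite := Set.toFinite _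
  have hncard : s.ncard ≤ m - ρ := by
    refine (Set.ncard_image_le (Set.toFinite _)).trans ?_
    rw [Set.ncard_compl, Set.ncard_range_of_injective a.injective, Nat.card_fin, Nat.card_fin]
  set W := Z.submatrix a b
  have hin : ∀ i, i ∉ Set.range a → y i ∈ C := fun i hi => Algebra.subset_adjoin ⟨i, hi, rfl⟩
  have hrel : ∀ j, ∑ i, W i j • y (a i) ∈ C := by
    intro j
    have h1 := hZ (b j)
    rw [← Finset.sum_add_sum_compl (Finset.univ.image a)] at h1
    rw [Finset.sum_image fun _ _ _ _ h => a.injective h] at h1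
    rw [show ∑ i, W i j • y (a i) = _ from eq_neg_of_add_eq_zero_left h1]
    refine neg_mem (sum_mem fun i hi => Subalgebra.smul_mem _ (hin i ?_) _)
    simpa using hi
  have hmul : ∀ l, W.det • y (a l) ∈ C := by
    intro l
    have h1 : W.det • y (a l) = ∑ j, W.adjugate j l • ∑ i, W i j • y (a i) := by
      simp only [Finset.smul_sum, smul_smul]
      rw [Finset.sum_comm]
      simp only [← Finset.sum_smul]
      have h2 : ∀ i, ∑ j, W.adjugate j l * W i j = (W.det • (1 : Matrix _ _ D₀)) i l := fun i => by
        rw [← W.mul_adjugate, Matrix.mul_apply]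
        simp only [mul_comm]
      simp only [h2, Matrix.smul_apply, Matrix.one_apply, smul_eq_mul, mul_ite, mul_one, mul_zero,
        ite_smul, zero_smul, Finset.sum_ite_eq', Finset.mem_univ, if_true]
    rw [h1]
    exact sum_mem fun j _ => Subalgebra.smul_mem _ (hrel j) _
  have hCinj : Function.Injective (algebraMap C D) := Subtype.val_injective
  have halg : ∀ i, IsAlgebraic C (y i) := by
    intro i
    by_cases hi : i ∈ Set.range a
    · obtain ⟨l, rfl⟩ := hi
      let δ : C := algebraMap D₀ C W.det
      have hδ : δ ≠ 0 := fun h => hdet (hinj (by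
        rw [map_zero]
        exact congrArg (algebraMap C D) h))
      refine ⟨Polynomial.C δ * Polynomial.X - Polynomial.C ⟨_, hmul l⟩, fun h => hδ ?_, ?_⟩
      · simpa using congrArg (fun P => P.coeff 1) h
      · rw [map_sub, map_mul, Polynomial.aeval_C, Polynomial.aeval_C, Polynomial.aeval_X,
          sub_eq_zero]
        exact (Algebra.smul_def W.det (y (a l))).symm
    · exact isAlgebraic_algebraMap (⟨y i, hin i hi⟩ : C)
  have : Algebra.IsAlgebraic C D := by
    refine ⟨fun x => ?_⟩
    have hx : x ∈ Algebra.adjoin D₀ (Set.range y) := hy ▸ trivial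
    induction hx using Algebra.adjoin_induction with
    | mem x hx =>
      obtain ⟨i, rfl⟩ := hx
      exact halg i
    | algebraMap c => exact isAlgebraic_algebraMap (algebraMap D₀ C c)
    | add x z _ _ hx hz => exact hx.add hz
    | mul x z _ _ hx hz => exact hx.mul hz
  exact (tdim_le_ncard_of_isAlgebraic D₀ D s hs).trans hncard

theorem tdim_le_sub_of_minor_of_isScalarTower {A B D : Type*} [CommRing A] [CommRing B] [CommRing D]
    [IsDomain D] [Algebra A D] [Algebra A B] [Algebra B D] [IsScalarTower A B D]
    (hinj : Function.Injective (algebraMap B D)) {m q ρ : ℕ}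
    (y : Fin m → D) (hy : Algebra.adjoin A (Set.range y) = ⊤) (Z : Matrix (Fin m) (Fin q) A)
    (hZ : ∀ j, ∑ i, Z i j • y i = 0) (a : Fin ρ ↪o Fin m) (b : Fin ρ ↪o Fin q)
    (hdet : algebraMap A B (Z.submatrix a b).det ≠ 0) : tdim B D ≤ m - ρ := by
  refine tdim_le_sub_of_minor hinj y ?_ (Z.map (algebraMap A B)) (fun j => ?_) a b ?_
  · have h : Algebra.adjoin A (Set.range y) ≤
        (Algebra.adjoin B (Set.range y)).restrictScalars A :=
      Algebra.adjoin_le Algebra.subset_adjoin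
    rw [hy] at h
    exact eq_top_iff.2 fun x _ => h (x := x) trivial
  · simpa only [Matrix.map_apply, algebraMap_smul] using hZ j
  · rwa [Matrix.submatrix_map, ← RingHom.mapMatrix_apply, ← RingHom.map_det]

theorem ringKrullDim_le_fittingDefect {k A D : Type*} [Field k] [CommRing A] [Algebra k A]
    [Algebra.FiniteType k A] [CommRing D] [IsDomain D] [Algebra k D] [Algebra A D]
    [IsScalarTower k A D] {d r m q : ℕ} (hd : ringKrullDim A = d) (Z : Matrix (Fin m) (Fin q) A)
    (hr : m ≤ matrixRank Z + r) (y : Fin m → D) (hy : Algebra.adjoin A (Set.range y) = ⊤)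
    (hZ : ∀ j, ∑ i, Z i j • y i = 0) :
    ringKrullDim D ≤ (((d + r : ℕ) + fittingDefect Z : ℕ∞) : WithBot ℕ∞) := by
  classical
  let p : Ideal A := RingHom.ker (algebraMap A D)
  have hp : p.IsPrime := RingHom.ker_isPrime _
  let _ : Algebra (A ⧸ p) D := (Ideal.Quotient.lift p (algebraMap A D) fun _ h => h).toAlgebra
  have : IsScalarTower A (A ⧸ p) D := .of_algebraMap_eq fun _ => rfl
  have : IsScalarTower k (A ⧸ p) D := .of_algebraMap_eq fun c =>
    IsScalarTower.algebraMap_apply k A D c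
  have hinj : Function.Injective (algebraMap (A ⧸ p) D) := RingHom.kerLift_injective _
  have hfin : Algebra.FiniteType A D := ⟨⟨(Set.finite_range y).toFinset, by simpa using hy⟩⟩
  have : Algebra.FiniteType k D := .trans (S := A) inferInstance inferInstance
  let P : ℕ → Prop := fun t => ¬ minorsIdeal Z t ≤ p
  -- `ρ` is the rank of `Z` at `p`. The search is well founded at `t = 0`, since the empty minor is
  -- `1`.
  let ρ := Nat.findGreatest P (min m q)
  have hP0 : P 0 := fun h => hp.ne_top (Ideal.eq_top_of_isUnit_mem _
    (h (Ideal.subset_span ⟨⟨⟨Fin.elim0, fun i => i.elim0⟩, fun {i} => i.elim0⟩,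
      ⟨⟨Fin.elim0, fun i => i.elim0⟩, fun {i} => i.elim0⟩, rfl⟩)) (by
        rw [Matrix.det_isEmpty]
        exact isUnit_one))
  have hρ : P ρ := Nat.findGreatest_spec (Nat.zero_le _) hP0
  have hρm : ρ ≤ m := (Nat.findGreatest_le _).trans (min_le_left _ _)
  obtain ⟨a, b, hab⟩ : ∃ (a : Fin ρ ↪o Fin m) (b : Fin ρ ↪o Fin q),
      (Z.submatrix a b).det ∉ p := by
    by_contra! h
    exact hρ (Ideal.span_le.2 fun x ⟨a, b, hx⟩ => hx ▸ h a b)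
  have htd : tdim (A ⧸ p) D ≤ m - ρ :=
    tdim_le_sub_of_minor_of_isScalarTower hinj y hy Z hZ a b fun h =>
      hab (Ideal.Quotient.eq_zero_iff_mem.1 h)
  set δ := tdim k (A ⧸ p)
  have hD : ringKrullDim D ≤ ((δ + (m - ρ) : ℕ) : ℕ∞) := by
    rw [ringKrullDim_eq_tdim k, tdim_add_eq k (A ⧸ p) D (algebraMap k _).injective hinj]
    exact_mod_cast Nat.add_le_add_left htd δ
  refine hD.trans (WithBot.coe_le_coe.2 ?_)
  have hht : p.height + δ ≤ d := by
    have := height_add_ringKrullDim_quotient_le p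
    rw [hd, ringKrullDim_eq_tdim k] at this
    exact_mod_cast this
  obtain ⟨hgt, hhgt⟩ := ENat.ne_top_iff_exists.1
    (ne_top_of_le_ne_top (ENat.natCast_ne_top d) (le_self_add.trans hht))
  rw [← hhgt] at hht
  have hht' : hgt + δ ≤ d := by exact_mod_cast hht
  rcases le_or_gt (matrixRank Z) ρ with hle | hlt
  · refine le_trans ?_ (le_self_add : _ ≤ _ + fittingDefect Z)
    have : δ + (m - ρ) ≤ d + r := by omega
    exact_mod_cast this
  -- By maximality of `ρ`, the ideal `I_{ρ+1}` lies in `p`. The term `t = ρ + 1` of the defect is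
  -- `rk - ρ - ht I_{ρ+1}`, exactly the excess to be absorbed.
  · have hrk : matrixRank Z ≤ min m q := Nat.findGreatest_le _
    have hmin : minorsIdeal Z (ρ + 1) ≤ p := by
      have := Nat.findGreatest_is_greatest (P := P) (Nat.lt_succ_self ρ) (by omega)
      exact not_not.1 this
    have h1 : (minorsIdeal Z (ρ + 1)).height ≤ hgt := (Ideal.height_mono hmin).trans hhgt.ge
    have h2 : ((matrixRank Z - (ρ + 1) + 1 - hgt : ℕ) : ℕ∞) ≤ fittingDefect Z := by
      have h3 : ((matrixRank Z - (ρ + 1) + 1 : ℕ) : ℕ∞) - (minorsIdeal Z (ρ + 1)).height ≤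
          fittingDefect Z :=
        Finset.le_sup (f := fun t => ((matrixRank Z - t + 1 : ℕ) : ℕ∞) - (minorsIdeal Z t).height)
          (Finset.mem_Icc.2 ⟨Nat.succ_pos ρ, hlt⟩)
      refine le_trans ?_ h3
      rw [ENat.natCast_sub]
      exact tsub_le_tsub_left h1 _
    refine le_trans ?_ (add_le_add_right h2 _)
    have : δ + (m - ρ) ≤ d + r + (matrixRank Z - (ρ + 1) + 1 - hgt) := by omega
    exact_mod_cast this

end FittingBound

end ModuleAluffi

namespace ModuleAluffi

/-! ### The bounds for the embedded Aluffi algebra -/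

section Bounds

open MvPolynomial

theorem mem_associatedPrimes_of_mem_minimalPrimes {A : Type*} [CommRing A] [IsNoetherianRing A]
    {p : Ideal A} (hp : p ∈ minimalPrimes A) : p ∈ associatedPrimes A A := by
  refine Module.associatedPrimes.minimalPrimes_annihilator_subset_associatedPrimes A A ?_
  rwa [Module.annihilator_eq_bot.2 inferInstance]

theorem ringKrullDim_embeddedAluffi_le_fittingDefect {k R A : Type*} [Field k] [CommRing R]
    [CommRing A] [Algebra k A] [Algebra.FiniteType k A] (f : R →+* A) {d r n m q : ℕ}
    (hd : ringKrullDim A = d) {E : Type*} [AddCommGroup E] [Module A E] (hr : HasRank A E r)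
    (φ : (E ⧸ Submodule.torsion A E) →ₗ[A] (Fin n → A))
    (Z : Matrix (Fin m) (Fin q) A) (π : (Fin m → A) →ₗ[A] E) (hπ : Function.Surjective π)
    (hZ : LinearMap.range Z.mulVecLin = LinearMap.ker π) :
    ringKrullDim (EmbeddedAluffi f (LinearMap.range φ)) ≤
      (((d + r : ℕ) + fittingDefect Z : ℕ∞) : WithBot ℕ∞) := by
  classical
  have : IsNoetherianRing A := Algebra.FiniteType.isNoetherianRing k A
  have : Nontrivial A := by
    by_contra h
    rw [not_nontrivial_iff_subsingleton] at h
    rw [ringKrullDim_eq_bot_of_subsingleton] at hd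
    exact WithBot.bot_ne_coe hd
  obtain ⟨p, hp⟩ := Ideal.nonempty_minimalPrimes (bot_ne_top (α := Ideal A))
  have hpp : p.IsPrime := hp.1.1
  have hm := le_matrixRank_add hr p (mem_associatedPrimes_of_mem_minimalPrimes hp) Z π hπ hZ
  set N := LinearMap.range φ
  refine ringKrullDim_le_of_forall_quotient_le _ fun Q hQ => ?_
  let B := EmbeddedAluffi f N
  let _ : Algebra k (B ⧸ Q) := Algebra.compHom (B ⧸ Q) (algebraMap k A)
  have : @IsScalarTower k A (B ⧸ Q) Algebra.toSMul Algebra.toSMul Algebra.toSMul :=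
    .of_algebraMap_eq fun _ => rfl
  let σ : SymmetricAlgebra A N →ₐ[A] B ⧸ Q :=
    (Ideal.Quotient.mkₐ A Q).comp (Ideal.Quotient.mkₐ A (aluffiIdeal f N))
  have hσ : Function.Surjective σ :=
    Ideal.Quotient.mk_surjective.comp Ideal.Quotient.mk_surjective
  -- The presentation of `E` also generates its quotient `N`, and the columns of `Z` remain
  -- relations there, though perhaps not all of them.
  let θ : (Fin m → A) →ₗ[A] N := φ.rangeRestrict ∘ₗ (Submodule.mkQ _) ∘ₗ π
  have hθ : Function.Surjective θ :=
    φ.surjective_rangeRestrict.comp ((Submodule.mkQ_surjective _).comp hπ)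
  let Y : (Fin m → A) →ₗ[A] B ⧸ Q := σ.toLinearMap ∘ₗ SymmetricAlgebra.ι A N ∘ₗ θ
  have hY : ∀ w : Fin m → A, Y w = ∑ i, w i • Y (Pi.single i 1) := fun w => by
    conv_lhs => rw [pi_eq_sum_univ' w]
    simp only [map_sum, map_smul]
  refine ringKrullDim_le_fittingDefect (k := k) (A := A) hd Z hm (fun i => Y (Pi.single i 1)) ?_ ?_
  · refine eq_top_iff.2 fun z _ => ?_
    obtain ⟨z, rfl⟩ := hσ z
    induction z using SymmetricAlgebra.induction with
    | algebraMap c =>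
      rw [σ.commutes]
      exact Subalgebra.algebraMap_mem _ c
    | ι x =>
      obtain ⟨w, rfl⟩ := hθ x
      change Y w ∈ _
      rw [hY]
      exact sum_mem fun i _ => Subalgebra.smul_mem _ (Algebra.subset_adjoin (Set.mem_range_self i)) _
    | mul a b ha hb =>
      rw [map_mul]
      exact mul_mem (ha trivial) (hb trivial)
    | add a b ha hb =>
      rw [map_add]
      exact add_mem (ha trivial) (hb trivial)
  · intro j
    have h1 : π (fun i => Z i j) = 0 := by
      rw [← LinearMap.mem_ker, ← hZ]
      exact ⟨Pi.single j 1, by ext i; simp⟩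
    rw [← hY fun i => Z i j]
    change σ (SymmetricAlgebra.ι A N (φ.rangeRestrict (Submodule.mkQ _ (π _)))) = 0
    rw [h1]
    simp only [map_zero]

/-- Injectivity of `φ` need not survive reduction modulo `p`, so write `p = Ann(a)`. A relation
modulo `p` becomes an honest relation in `A^n` after multiplication by `a`, hence a torsion element
of `E`. Clearing it by a nonzerodivisor and using the freeness of `E_p` puts the coefficients back
in `p`. -/
theorem HasRank.exists_linearIndependent {A E : Type*} [CommRing A] [IsNoetherianRing A]
    [AddCommGroup E] [Module A E] {r n : ℕ} (hr : HasRank A E r) (p : Ideal A) [p.IsPrime]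
    (hp : p ∈ associatedPrimes A A) (φ : (E ⧸ Submodule.torsion A E) →ₗ[A] (Fin n → A))
    (hφ : Function.Injective φ) :
    ∃ x : Fin r → LinearMap.range φ, LinearIndependent (FractionRing (A ⧸ p))
      fun i j => algebraMap A (FractionRing (A ⧸ p)) ((x i : Fin n → A) j) := by
  obtain ⟨e, he, -⟩ := hr.exists_generators p hp
  obtain ⟨-, a, ha⟩ := isAssociatedPrime_iff.1 hp
  have hpa : ∀ c, c ∈ p ↔ c * a = 0 := fun c => by
    rw [ha]
    simp [Submodule.mem_colon_singleton]
  refine ⟨fun i => φ.rangeRestrict (Submodule.Quotient.mk (e i)), ?_⟩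
  rw [← LinearIndependent.iff_fractionRing (A ⧸ p), Fintype.linearIndependent_iff]
  intro c' hc
  choose c hc' using fun i => Ideal.Quotient.mk_surjective (c' i)
  have h1 : ∀ j, ∑ i, c i * φ (Submodule.Quotient.mk (e i)) j ∈ p := fun j => by
    rw [← Ideal.Quotient.eq_zero_iff_mem]
    apply FaithfulSMul.algebraMap_injective (A ⧸ p) (FractionRing (A ⧸ p))
    have := congrFun hc j
    simp only [Finset.sum_apply, Pi.zero_apply, ← hc', Algebra.smul_def] at this
    rw [map_zero, ← this, map_sum, map_sum]
    refine Finset.sum_congr rfl fun i _ => ?_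
    rw [map_mul, map_mul]
    rfl
  have h2 : ∑ i, (c i * a) • e i ∈ Submodule.torsion A E := by
    rw [← Submodule.Quotient.mk_eq_zero]
    apply hφ
    ext j
    have h3 := (hpa _).1 (h1 j)
    rw [← Submodule.mkQ_apply, map_zero, map_sum, map_sum, Finset.sum_apply, Pi.zero_apply, ← h3,
      Finset.sum_mul]
    refine Finset.sum_congr rfl fun i _ => ?_
    rw [map_smul, map_smul, Pi.smul_apply, smul_eq_mul, Submodule.mkQ_apply]
    ring
  obtain ⟨⟨b, hb⟩, h4⟩ := (Submodule.mem_torsion_iff _).1 h2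
  have h5 : ∑ i, (b * (c i * a)) • e i = 0 := by
    rw [← h4, Submonoid.mk_smul, Finset.smul_sum]
    simp only [mul_smul]
  intro i
  obtain ⟨s, hs, hsi⟩ := he _ h5 i
  rw [← hc', Ideal.Quotient.eq_zero_iff_mem]
  refine (Ideal.IsPrime.mem_or_mem (I := p) inferInstance ((hpa (s * c i)).2 ?_)).resolve_left hs
  refine (mem_nonZeroDivisors_iff.1 hb).1 _ ?_
  rw [← hsi]
  ring

/-- The image of `Ω` is a domain containing `A/p` and `r` algebraically independent elements. -/
theorem tdim_add_le_ringKrullDim {k A S : Type*} [Field k] [CommRing A] [Algebra k A]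
    [Algebra.FiniteType k A] [CommRing S] [Algebra A S] [Algebra.FiniteType A S] (p : Ideal A)
    [p.IsPrime] {r : ℕ} (Ω : S →ₐ[A] MvPolynomial (Fin r) (FractionRing (A ⧸ p)))
    (z : Fin r → S) (hz : ∀ i, Ω (z i) = X i) :
    ((tdim k (A ⧸ p) + r : ℕ) : WithBot ℕ∞) ≤ ringKrullDim S := by
  let K := FractionRing (A ⧸ p)
  let D := S ⧸ RingHom.ker Ω
  have : (RingHom.ker Ω).IsPrime := RingHom.ker_isPrime _
  have : IsDomain D := Ideal.Quotient.isDomain _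
  let _ : Algebra k S := Algebra.compHom S (algebraMap k A)
  have : IsScalarTower k A S := .of_algebraMap_eq fun _ => rfl
  have : Algebra.FiniteType k S := .trans (S := A) inferInstance inferInstance
  let g : A ⧸ p →+* D := Ideal.Quotient.lift p (algebraMap A D) fun x hx => by
    rw [IsScalarTower.algebraMap_apply A S D]
    refine Ideal.Quotient.eq_zero_iff_mem.2 ?_
    rw [RingHom.mem_ker, Ω.commutes, IsScalarTower.algebraMap_apply A (A ⧸ p),
      Ideal.Quotient.algebraMap_eq, Ideal.Quotient.eq_zero_iff_mem.2 hx, map_zero]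
  let _ : Algebra (A ⧸ p) D := g.toAlgebra
  have : IsScalarTower A (A ⧸ p) D := .of_algebraMap_eq fun _ => rfl
  have : IsScalarTower k (A ⧸ p) D := .of_algebraMap_eq fun _ => rfl
  let ω : D →ₐ[A ⧸ p] MvPolynomial (Fin r) K :=
    { Ideal.kerLiftAlg Ω with
      commutes' := fun c => by
        obtain ⟨c, rfl⟩ := Ideal.Quotient.mk_surjective c
        exact (Ideal.kerLiftAlg Ω).commutes c }
  have hinj : Function.Injective (algebraMap (A ⧸ p) D) := by
    refine Function.Injective.of_comp (f := ω) ?_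
    have : ω ∘ algebraMap (A ⧸ p) D = algebraMap (A ⧸ p) (MvPolynomial (Fin r) K) :=
      funext ω.commutes
    rw [this]
    exact FaithfulSMul.algebraMap_injective _ _
  have hind : AlgebraicIndependent (A ⧸ p) fun i => (Ideal.Quotient.mk _ (z i) : D) := by
    refine AlgebraicIndependent.of_comp ω ?_
    have : (ω ∘ fun i => (Ideal.Quotient.mk _ (z i) : D)) = X := funext hz
    rw [this]
    exact (algebraicIndependent_X (Fin r) K).restrictScalars
      (FaithfulSMul.algebraMap_injective (A ⧸ p) K)
  have : Algebra.FiniteType (A ⧸ p) D := .of_restrictScalars_finiteType k _ _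
  have h1 : ringKrullDim D ≤ ringKrullDim S :=
    ringKrullDim_le_of_surjective (Ideal.Quotient.mk _) Ideal.Quotient.mk_surjective
  refine le_trans ?_ h1
  rw [ringKrullDim_eq_tdim k, tdim_add_eq k (A ⧸ p) D (algebraMap k _).injective hinj]
  have h2 := le_tdim_of_algebraicIndependent (A ⧸ p) D hind
  rw [Nat.card_fin] at h2
  exact_mod_cast Nat.add_le_add_left h2 _

/-- Applying `f` to coefficients sends Rees relations over `R` to Rees relations over `A`, so the
Aluffi algebra maps onto the Rees algebra of `N`. -/
theorem aluffiIdeal_le_ker {R A : Type*} [CommRing R] [CommRing A] (f : R →+* A) {n : ℕ}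
    (N : Submodule A (Fin n → A)) : aluffiIdeal f N ≤ RingHom.ker (reesMap N) := by
  have h1 : (reesMap N).toRingHom.comp (symMap f (deformationMap f N)) =
      (MvPolynomial.map f).comp (reesMap (deformation f N)).toRingHom := by
    refine symHom_ext (fun c => ?_) (fun x => ?_)
    · simp [symMap_algebraMap]
    · simp [symMap_ι, reesMap_ι, linForm_apply, deformationMap, coordMap]
  refine Ideal.map_le_iff_le_comap.2 fun z hz => ?_
  rw [mem_reesIdeal_iff_reesMap] at hz
  have h2 := RingHom.congr_fun h1 z
  simp only [RingHom.comp_apply, AlgHom.toRingHom_eq_coe, RingHom.coe_coe, hz, map_zero] at h2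
  exact h2

theorem le_ringKrullDim_embeddedAluffi {k R A : Type*} [Field k] [CommRing R]
    [CommRing A] [Algebra k A] [Algebra.FiniteType k A] (f : R →+* A)
    (hequi : IsEquidimensional A) {d r n : ℕ} (hd : ringKrullDim A = d) {E : Type*}
    [AddCommGroup E] [Module A E] (hr : HasRank A E r)
    (φ : (E ⧸ Submodule.torsion A E) →ₗ[A] (Fin n → A)) (hφ : Function.Injective φ) :
    ((d + r : ℕ) : WithBot ℕ∞) ≤ ringKrullDim (EmbeddedAluffi f (LinearMap.range φ)) := by
  classical
  have : IsNoetherianRing A := Algebra.FiniteType.isNoetherianRing k A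
  have : Nontrivial A := by
    by_contra h
    rw [not_nontrivial_iff_subsingleton] at h
    rw [ringKrullDim_eq_bot_of_subsingleton] at hd
    exact WithBot.bot_ne_coe hd
  obtain ⟨p, hp⟩ := Ideal.nonempty_minimalPrimes (bot_ne_top (α := Ideal A))
  have hpp : p.IsPrime := hp.1.1
  let N := LinearMap.range φ
  obtain ⟨x, hx⟩ : ∃ x : Fin r → N, _ :=
    hr.exists_linearIndependent p (mem_associatedPrimes_of_mem_minimalPrimes hp) φ hφ
  let K := FractionRing (A ⧸ p)
  have hdim : tdim k (A ⧸ p) = d := by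
    have h2 := hequi p hp
    rw [hd, ringKrullDim_eq_tdim k] at h2
    exact_mod_cast h2
  obtain ⟨ψ, hψ⟩ := LinearMap.exists_leftInverse_of_injective
    (Fintype.linearCombination K fun i j => algebraMap A K ((x i : Fin n → A) j))
    (LinearMap.ker_eq_bot.2 (linearIndependent_iff_injective_fintypeLinearCombination.1 hx))
  have hψx : ∀ i, ψ (fun j => algebraMap A K ((x i : Fin n → A) j)) = Pi.single i 1 := fun i => by
    have := LinearMap.congr_fun hψ (Pi.single i 1)
    simpa [Fintype.linearCombination_apply_single] using this
  -- This is the linear substitution induced by `ψ`, a left inverse over `K` to the inclusion of the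
  -- span of the `x i`; it sends the linear form of `x i` to the variable `X i`.
  let Θ : MvPolynomial (Fin n) A →ₐ[A] MvPolynomial (Fin r) K :=
    aeval fun j => linForm K r (ψ (Pi.single j 1))
  have hΘ : ∀ w : Fin n → A, Θ (linForm A n w) = linForm K r (ψ fun j => algebraMap A K (w j)) := by
    intro w
    conv_rhs => rw [pi_eq_sum_univ' fun j => algebraMap A K (w j)]
    rw [linForm_apply, map_sum, map_sum, map_sum]
    refine Finset.sum_congr rfl fun j _ => ?_
    rw [map_mul, aeval_X, map_smul, map_smul, algebraMap_smul, ← algebraMap_eq, Θ.commutes,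
      Algebra.smul_def]
  let Ω : EmbeddedAluffi f N →ₐ[A] MvPolynomial (Fin r) K :=
    Ideal.Quotient.liftₐ (aluffiIdeal f N) (Θ.comp (reesMap N)) fun z hz => by
      have : reesMap N z = 0 := aluffiIdeal_le_ker f N hz
      rw [AlgHom.comp_apply, this, map_zero]
  have : Algebra.FiniteType A (SymmetricAlgebra A N) := symmetricAlgebra_finiteType A N
  rw [← hdim]
  refine tdim_add_le_ringKrullDim p Ω
    (fun i => Ideal.Quotient.mk _ (SymmetricAlgebra.ι A N (x i))) fun i => ?_
  change Θ (reesMap N (SymmetricAlgebra.ι A N (x i))) = X i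
  rw [reesMap_ι, hΘ, hψx, linForm_apply, Finset.sum_eq_single i]
  · simp
  · intro j _ hj
    simp [hj]
  · simp

end Bounds

end ModuleAluffi

/-! ### The three bounds, transported to the inverse limit. -/

open ModuleAluffi in
theorem proposition2p6
    (k : Type*) [Field k] [PerfectField k]
    {R : Type*} [CommRing R] [Algebra k R] [Algebra.FiniteType k R] [Algebra.Smooth k R]
    {A : Type*} [CommRing A] [Algebra k A]
    (π : R →ₐ[k] A) (hπ : Function.Surjective π)
    (hcat : IsCatenary A) (hequi : IsEquidimensional A)
    (d g : ℕ) (hd : ringKrullDim A = d)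
    (hg : (RingHom.ker π).height = g)
    (hJ : ∀ P ∈ (RingHom.ker π).minimalPrimes, P.height = (RingHom.ker π).height)
    {E : Type*} [AddCommGroup E] [Module A E] [Module.Finite A E]
    (r n : ℕ) (hr : HasRank A E r)
    (φ : (E ⧸ Submodule.torsion A E) →ₗ[A] (Fin n → A)) (hφ : Function.Injective φ)
    {m q : ℕ} (Z : Matrix (Fin m) (Fin q) A) (p : (Fin m → A) →ₗ[A] E)
    (hp : Function.Surjective p)
    (hZ : LinearMap.range Z.mulVecLin = LinearMap.ker p) :
    ((d + r : ℕ) : WithBot ℕ∞) ≤ ringKrullDim (aluffiAlgebra k (LinearMap.range φ)) ∧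
      ringKrullDim (aluffiAlgebra k (LinearMap.range φ)) ≤
        min ((d + n + g : ℕ) : WithBot ℕ∞) (((d + r : ℕ) + fittingDefect Z : ℕ∞) : WithBot ℕ∞) := by
  have : Algebra.FiniteType k A := .of_surjective π hπ
  obtain ⟨ε⟩ := aluffiAlgebra_equiv_of_smooth π hπ (LinearMap.range φ)
  rw [ringKrullDim_eq_of_ringEquiv ε]
  exact ⟨le_ringKrullDim_embeddedAluffi (k := k) _ hequi hd hr φ hφ,
    le_min (ringKrullDim_embeddedAluffi_le π hπ hequi d g hd hg hJ _)
      (ringKrullDim_embeddedAluffi_le_fittingDefect (k := k) _ hd hr φ Z p hp hZ)⟩
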